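/- **Setting.** Let $E$ be a finite-dimensional real normed space and $a:E\to E$ a force field; consider $\dot q=v,\ \dot v=a(q)$. On functions of $(q,v)\in E\times E$ put $A=v\cdot\partial_q$, $B=a(q)\cdot\partial_v$; then $(e^{tA}f)(q,v)=f(q+tv,v)$ and $(e^{tB}f)(q,v)=f(q,v+t\,a(q))$. Let $\mathcal T_2(h)=e^{\frac h2B}e^{hA}e^{\frac h2B}$ (velocity Verlet). For a finite set $K$ of positive integers let $c_k=\prod_{j\in K,\,j\ne k}\frac{k^2}{k^2-j^2}$; the $K$-integrator with step $h$ maps $(q_0,v_0)$ to the values at $(q_0,v_0)$ of $\sum_{k\in K}c_k\mathcal T_2^k(h/k)$ applied to the coordinate functions $q$ and $v$. Let $q_{i/k}$ be the position after $i$ Verlet steps of size $h/k$ from $(q_0,v_0)$, $a_{i/k}=a(q_{i/k})$, $a_0=a(q_0)$. Put $$q^*_{1/2}=q_0+\tfrac h2v_0+\tfrac{h^2}{24}(4a_{1/4}-a_0),\qquad q_1^\dagger=q_0+hv_0+\tfrac{h^2}{14}(6a_{1/4}+4a_{2/4}-5a_{1/2}+2a_{3/4}),$$ $$q^*_{3/4}=q_0+\tfrac34hv_0+\tfrac{h^2}{32}(3a_0+4a_{1/4}+2a^*_{1/2}),\qquad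 q^*_1=q_0+hv_0+\tfrac{h^2}{14}(6a_{1/4}-a^*_{1/2}+2a^*_{3/4}),$$ with $a^*_{1/2}=a(q^*_{1/2})$, $a^*_{3/4}=a(q^*_{3/4})$, $a^*_1=a(q^*_1)$. **Theorem.** (1) For every $a$, $h$, $q_0$, $v_0$: the operator of $\{1,2,4\}$ is $\frac1{45}\mathcal T_2(h)-\frac49\mathcal T_2^2(\frac h2)+\frac{64}{45}\mathcal T_2^4(\frac h4)$, and the $\{1,2,4\}$-integrator is $$q=q_0+hv_0+\tfrac{h^2}{90}(7a_0+24a_{1/4}+16a_{2/4}-10a_{1/2}+8a_{3/4}),$$ $$v=v_0+\tfrac h{90}(7a_0+32a_{1/4}+32a_{2/4}-20a_{1/2}+32a_{3/4}+16a_{4/4}-10a_{2/2}+a_{1/1}),$$ with $q_{1/1}=q_0+hv_0+\frac{h^2}2a_0$, $q_{1/2}=q_0+\frac h2v_0+\frac{h^2}8a_0$, $q_{2/2}=q_0+hv_0+\frac{h^2}4(a_0+a_{1/2})$, $q_{1/4}=q_0+\frac h4v_0+\frac{h^2}{32}a_0$, $q_{2/4}=q_0+\frac h2v_0+\frac{h^2}{16}(a_0+a_{1/4})$,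 $q_{3/4}=q_0+\frac34hv_0+\frac{h^2}{32}(3a_0+4a_{1/4}+2a_{2/4})$, $q_{4/4}=q_0+hv_0+\frac{h^2}{16}(2a_0+3a_{1/4}+2a_{2/4}+a_{3/4})$. It is the explicit Runge–Kutta–Nyström (RKN) method whose eight stages (force evaluations) are at $q_0,q_{1/4},q_{1/2},q_{2/4},q_{3/4},q_{1/1},q_{2/2},q_{4/4}$. (2) Albrecht's method $$q^{A}=q_0+hv_0+\tfrac{h^2}{90}(7a_0+24a_{1/4}+6a^*_{1/2}+8a^*_{3/4}),$$ $$v^{A}=v_0+\tfrac h{90}(7a_0+32a_{1/4}+12a^*_{1/2}+32a^*_{3/4}+7a^*_1)$$ is the explicit RKN method with the five stages $q_0,q_{1/4},q^*_{1/2},q^*_{3/4},q^*_1$. Moreover $q^*_{3/4}=q_{3/4}+\frac{h^2}{16}(a^*_{1/2}-a_{2/4})$. (3) Let $a$ be $C^\infty$ on an open set containing $q_0$. As $h\to0$, for fixed $q_0,v_0$: $$16a_{2/4}-10a_{1/2}=6a^*_{1/2}+O(h^6),\qquad 16a_{4/4}-10a_{2/2}+a_{1/1}=7a(q_1^\dagger)+O(h^6),$$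 $$q^*_{3/4}=q_{3/4}+O(h^5),\qquad q^*_1=q^\dagger_1+O(h^5),\qquad q^*_1=q_1^\dagger-\tfrac{h^2}{14}(a^*_{1/2}+4a_{2/4}-5a_{1/2})+O(h^7).$$ The two errors that the replacements of $q_{3/4}$ by $q^*_{3/4}$ and of $q_1^\dagger$ by $q_1^*$ cause in the velocity are of order $h^6$ with opposite leading terms, $$\tfrac h{90}\,32\,(a^*_{3/4}-a_{3/4})=\tfrac{h^6}{1728}\,Da(q_0)^3v_0+O(h^7),\qquad \tfrac h{90}\,7\,(a^*_1-a(q_1^\dagger))=-\tfrac{h^6}{1728}\,Da(q_0)^3v_0+O(h^7),$$ so their sum is $O(h^7)$. The positions and the velocities given by the $\{1,2,4\}$-integrator and by Albrecht's method differ by $O(h^7)$. Finally, if $(q(t),v(t))$ solves $\dot q=v,\ \dot v=a(q)$ near $t=0$ with $(q(0),v(0))=(q_0,v_0)$, then both methods are of sixth order: $q(h)$ and $v(h)$ differ from the position and the velocity given by either method by $O(h^7)$. -/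

import Mathlib

open Filter Asymptotics
open scoped Topology ContDiff

noncomputable section

namespace MultiProduct

variable {E : Type*} [NormedAddCommGroup E] [NormedSpace ℝ E]
variable {F : Type*} [NormedAddCommGroup F] [NormedSpace ℝ F]

/-! ### The Lie operators of `q' = v`, `v' = a q` and their exponentials

A point of phase space is a pair `(q, v) : E × E`.  Operators act on observables
`f : E × E → F`; the exponential of a first-order differential operator is the pull-back
along its flow. -/

/-- `A = v · ∂/∂q`. -/
def lieA (f : E × E → F) : E × E → F := fun z => fderiv ℝ f z (z.2, 0)

/-- `B = a(q) · ∂/∂v`. -/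
def lieB (a : E → E) (f : E × E → F) : E × E → F := fun z => fderiv ℝ f z (0, a z.1)

/-- `e^{tA}`: pull-back along the flow `(q, v) ↦ (q + t v, v)` of `A`. -/
def expA (t : ℝ) : Module.End ℝ (E × E → F) :=
  LinearMap.funLeft ℝ F (fun z : E × E => (z.1 + t • z.2, z.2))

/-- `e^{tB}`: pull-back along the flow `(q, v) ↦ (q, v + t a(q))` of `B`. -/
def expB (a : E → E) (t : ℝ) : Module.End ℝ (E × E → F) :=
  LinearMap.funLeft ℝ F (fun z : E × E => (z.1, z.2 + t • a z.1))

theorem expA_zero : (expA 0 : Module.End ℝ (E × E → F)) = 1 := by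
  ext f z
  simp [expA, LinearMap.funLeft]

theorem expB_zero (a : E → E) : (expB a 0 : Module.End ℝ (E × E → F)) = 1 := by
  ext f z
  simp [expB, LinearMap.funLeft]

theorem expA_hasDerivAt {f : E × E → F} (hf : Differentiable ℝ f) (z : E × E) (t : ℝ) :
    HasDerivAt (fun s => expA s f z) (expA t (lieA f) z) t := by
  have h1 : HasDerivAt (fun s : ℝ => (z.1 + s • z.2, z.2)) (z.2, (0 : E)) t := by
    have := ((hasDerivAt_id t).smul_const z.2).const_add z.1
    simpa using this.prodMk (hasDerivAt_const t z.2)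
  exact (hf _).hasFDerivAt.comp_hasDerivAt t h1

theorem expB_hasDerivAt (a : E → E) {f : E × E → F} (hf : Differentiable ℝ f) (z : E × E)
    (t : ℝ) : HasDerivAt (fun s => expB a s f z) (expB a t (lieB a f) z) t := by
  have h1 : HasDerivAt (fun s : ℝ => (z.1, z.2 + s • a z.1)) ((0 : E), a z.1) t := by
    have := ((hasDerivAt_id t).smul_const (a z.1)).const_add z.2
    simpa using (hasDerivAt_const t z.1).prodMk this
  exact (hf _).hasFDerivAt.comp_hasDerivAt t h1

/-- The symmetric second-order splitting `e^{hB/2} e^{hA} e^{hB/2}` (velocity Verlet). -/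
def T2 (a : E → E) (h : ℝ) : Module.End ℝ (E × E → F) :=
  expB a (h / 2) * expA h * expB a (h / 2)

/-- The extrapolation coefficient `c_k = ∏_{j ≠ k} k² / (k² - j²)`. -/
def extrapCoeff (K : Finset ℕ) (k : ℕ) : ℝ :=
  ∏ j ∈ K.erase k, (k : ℝ) ^ 2 / ((k : ℝ) ^ 2 - (j : ℝ) ^ 2)

/-- The multi-product operator `∑_{k ∈ K} c_k T₂(h/k)^k` of the set `K` of whole numbers. -/
def extrapolation (a : E → E) (K : Finset ℕ) (h : ℝ) : Module.End ℝ (E × E → F) :=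
  ∑ k ∈ K, extrapCoeff K k • T2 a (h / k) ^ k

/-- The integrator of `K`: the multi-product operator applied to the coordinate functions
`q` and `v`, evaluated at the initial point `z`. -/
def integrator (a : E → E) (K : Finset ℕ) (h : ℝ) (z : E × E) : E × E :=
  (extrapolation a K h Prod.fst z, extrapolation a K h Prod.snd z)

/-- `q_{i/k}`: the position reached (where the force is evaluated) after `i` steps of `T₂(h/k)`. -/
def point (a : E → E) (i k : ℕ) (h : ℝ) (z : E × E) : E :=
  (T2 a (h / k) ^ i) Prod.fst z

/-- `a_{i/k} = a(q_{i/k})`. -/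
def force (a : E → E) (i k : ℕ) (h : ℝ) (z : E × E) : E := a (point a i k h z)

/-! ### The consolidated evaluation points -/

/-- `q*_{1/2}` -/
def halfStar (a : E → E) (h : ℝ) (z : E × E) : E :=
  z.1 + (h / 2) • z.2 + (h ^ 2 / 24) • ((4 : ℝ) • force a 1 4 h z - a z.1)

/-- `q†_1` -/
def oneDagger (a : E → E) (h : ℝ) (z : E × E) : E :=
  z.1 + h • z.2 + (h ^ 2 / 14) •
    ((6 : ℝ) • force a 1 4 h z + (4 : ℝ) • force a 2 4 h z - (5 : ℝ) • force a 1 2 h z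
      + (2 : ℝ) • force a 3 4 h z)

/-- `q*_{3/4}`: `q_{3/4}` with `a_{2/4}` replaced by `a*_{1/2}`. -/
def threeQuarterStar (a : E → E) (h : ℝ) (z : E × E) : E :=
  z.1 + (3 / 4 * h) • z.2 + (h ^ 2 / 32) •
    ((3 : ℝ) • a z.1 + (4 : ℝ) • force a 1 4 h z + (2 : ℝ) • a (halfStar a h z))

/-- `q*_1`: `q†_1` with `a_{2/4}`, `a_{1/2}` replaced by `a*_{1/2}` and `a_{3/4}` by `a*_{3/4}`. -/
def oneStar (a : E → E) (h : ℝ) (z : E × E) : E :=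
  z.1 + h • z.2 + (h ^ 2 / 14) •
    ((6 : ℝ) • force a 1 4 h z - a (halfStar a h z) + (2 : ℝ) • a (threeQuarterStar a h z))

/-- One step of Albrecht's integrator. -/
def albrecht (a : E → E) (h : ℝ) (z : E × E) : E × E :=
  (z.1 + h • z.2 + (h ^ 2 / 90) •
      ((7 : ℝ) • a z.1 + (24 : ℝ) • force a 1 4 h z + (6 : ℝ) • a (halfStar a h z)
        + (8 : ℝ) • a (threeQuarterStar a h z)),
    z.2 + (h / 90) •
      ((7 : ℝ) • a z.1 + (32 : ℝ) • force a 1 4 h z + (12 : ℝ) • a (halfStar a h z)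
        + (32 : ℝ) • a (threeQuarterStar a h z) + (7 : ℝ) • a (oneStar a h z)))

/-! ### Runge-Kutta-Nyström methods -/

/-- The tableau of an explicit Runge-Kutta-Nyström method with `s` stages, that is, with `s`
force evaluations in each step. -/
structure ExplicitRKN (s : ℕ) where
  c : Fin s → ℝ
  A : Fin s → Fin s → ℝ
  bq : Fin s → ℝ
  bv : Fin s → ℝ
  explicit : ∀ i j, i ≤ j → A i j = 0

/-- One step of size `h` of the method leads from `z` to `w`; `Q i` is the point of the
`i`-th force evaluation. -/
def ExplicitRKN.IsStep {s : ℕ} (M : ExplicitRKN s) (a : E → E) (h : ℝ) (z w : E × E) : Prop :=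
  ∃ Q : Fin s → E,
    (∀ i, Q i = z.1 + (M.c i * h) • z.2 + h ^ 2 • ∑ j, M.A i j • a (Q j)) ∧
    w.1 = z.1 + h • z.2 + h ^ 2 • ∑ i, M.bq i • a (Q i) ∧
    w.2 = z.2 + h • ∑ i, M.bv i • a (Q i)

/-- The tableau with the eight stages
`q_0, q_{1/4}, q_{1/2}, q_{2/4}, q_{3/4}, q_{1/1}, q_{2/2}, q_{4/4}`. -/
def tableau124 : ExplicitRKN 8 where
  c := ![0, 1 / 4, 1 / 2, 1 / 2, 3 / 4, 1, 1, 1]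
  A := ![![0, 0, 0, 0, 0, 0, 0, 0],
         ![1 / 32, 0, 0, 0, 0, 0, 0, 0],
         ![1 / 8, 0, 0, 0, 0, 0, 0, 0],
         ![1 / 16, 1 / 16, 0, 0, 0, 0, 0, 0],
         ![3 / 32, 4 / 32, 0, 2 / 32, 0, 0, 0, 0],
         ![1 / 2, 0, 0, 0, 0, 0, 0, 0],
         ![1 / 4, 0, 1 / 4, 0, 0, 0, 0, 0],
         ![2 / 16, 3 / 16, 0, 2 / 16, 1 / 16, 0, 0, 0]]
  bq := ![7 / 90, 24 / 90, -10 / 90, 16 / 90, 8 / 90, 0, 0, 0]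
  bv := ![7 / 90, 32 / 90, -20 / 90, 32 / 90, 32 / 90, 1 / 90, -10 / 90, 16 / 90]
  explicit := by
    intro i j hij
    fin_cases i <;> fin_cases j <;> first | rfl | exact absurd hij (by decide)

/-- Albrecht's tableau, with five stages. -/
def tableauAlbrecht : ExplicitRKN 5 where
  c := ![0, 1 / 4, 1 / 2, 3 / 4, 1]
  A := ![![0, 0, 0, 0, 0],
         ![1 / 32, 0, 0, 0, 0],
         ![-1 / 24, 4 / 24, 0, 0, 0],
         ![3 / 32, 4 / 32, 2 / 32, 0, 0],
         ![0, 6 / 14, -1 / 14, 2 / 14, 0]]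
  bq := ![7 / 90, 24 / 90, 6 / 90, 8 / 90, 0]
  bv := ![7 / 90, 32 / 90, 12 / 90, 32 / 90, 7 / 90]
  explicit := by
    intro i j hij
    fin_cases i <;> fin_cases j <;> first | rfl | exact absurd hij (by decide)

/-- `(q, v)` solves `q' = v`, `v' = a(q)` near time `0` with initial value `z`. -/
structure IsSolution (a : E → E) (z : E × E) (q v : ℝ → E) : Prop where
  q_zero : q 0 = z.1
  v_zero : v 0 = z.2
  deriv_q : ∀ᶠ t in 𝓝 (0 : ℝ), HasDerivAt q (v t) t
  deriv_v : ∀ᶠ t in 𝓝 (0 : ℝ), HasDerivAt v (a (q t)) t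

end MultiProduct

end

open MultiProduct

/-! The exact statements are algebra. A pull-back operator evaluates `f` at a moved point, so `T2 a
h ^ i` evaluates `f` at the `i`-th Verlet iterate (`T2_pow_apply`). Eliminating the velocities
(`point_succ`) writes every point through forces at earlier points, and the formulas become linear
identities.

The asymptotic statements compare Taylor coefficients at `h = 0`. Every point has the form `q + c h
v + h² R(h)`, with `R` a linear combination of forces at earlier points. The jet of the force along
a curve follows from the jet of the curve by the chain rule (`HasJet.comp`, `HasJet.force`). The
factor `h²` gains two orders (`HasJet.position`), so the jets modulo `h^6` are found stage by stage.
Each is a combination of a few elementary differentials, recorded by eight rational numbers, and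
each estimate reduces to an identity between rationals.

Two facts explain the consolidation. First, `6 q*_{1/2} = 16 q_{2/4} - 10 q_{1/2}` and `7 q†_1 = 16
q_{4/4} - 10 q_{2/2} + q_{1/1}` hold exactly. The points averaged agree modulo `h³`, so taking the
force commutes with averaging up to the square of their deviation, which is `O(h^6)`. Second, the
remaining replacements alter positions first in degree 5, only in the coefficient of `Da² v`, and
the two changes cancel in the velocity.

For the exact solution, a jet of `q` inserted into the equation and integrated twice gains two
orders (`IsSolution.hasJet`). Sixth order is checked for the {1, 2, 4}-integrator; Albrecht's method
inherits it from the `O(h^7)` difference. -/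

namespace MultiProduct

universe u

/-! ### Calculus of truncated Taylor expansions at `h = 0` -/

section Jets

variable {E : Type u} [NormedAddCommGroup E] [NormedSpace ℝ E]
variable {F : Type*} [NormedAddCommGroup F] [NormedSpace ℝ F]
variable {G : Type*} [NormedAddCommGroup G] [NormedSpace ℝ G]

/-- `f h = ∑ i < n, h ^ i • w i + O(h ^ n)` as `h → 0`. -/
def HasJet (n : ℕ) (f : ℝ → F) (w : ℕ → F) : Prop :=
  (fun h : ℝ => f h - ∑ i ∈ Finset.range n, h ^ i • w i) =O[𝓝 0] fun h : ℝ => h ^ n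

theorem isBigO_pow_of_le {m n : ℕ} (hmn : m ≤ n) :
    (fun h : ℝ => h ^ n) =O[𝓝 0] fun h : ℝ => h ^ m := by
  obtain ⟨k, rfl⟩ := Nat.exists_eq_add_of_le hmn
  have h1 : (fun h : ℝ => h ^ k) =O[𝓝 0] fun _ : ℝ => (1 : ℝ) :=
    (continuous_pow k).continuousAt.isBigO_one ℝ
  simpa [pow_add] using (isBigO_refl (fun h : ℝ => h ^ m) (𝓝 0)).mul h1

namespace HasJet

variable {n : ℕ} {f g : ℝ → F} {w w' : ℕ → F}

theorem congr_coeff (hf : HasJet n f w) (hw : ∀ i < n, w i = w' i) : HasJet n f w' := by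
  have : ∀ h : ℝ, ∑ i ∈ Finset.range n, h ^ i • w' i = ∑ i ∈ Finset.range n, h ^ i • w i :=
    fun h => Finset.sum_congr rfl fun i hi => by rw [hw i (Finset.mem_range.1 hi)]
  simpa only [HasJet, this] using hf

theorem congr (hf : HasJet n f w) (hfg : ∀ h, g h = f h) (hw : ∀ i < n, w i = w' i) :
    HasJet n g w' := by
  rw [funext hfg]; exact hf.congr_coeff hw

theorem add (hf : HasJet n f w) (hg : HasJet n g w') :
    HasJet n (fun h => f h + g h) (fun i => w i + w' i) := by
  refine (IsBigO.add hf hg).congr_left fun h => ?_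
  simp only [smul_add, Finset.sum_add_distrib]; abel

theorem clm (hf : HasJet n f w) (L : F →L[ℝ] G) :
    HasJet n (fun h => L (f h)) (fun i => L (w i)) := by
  refine ((L.isBigO_comp _ _).trans hf).congr_left fun h => ?_
  simp

theorem const_smul (hf : HasJet n f w) (c : ℝ) :
    HasJet n (fun h => c • f h) (fun i => c • w i) :=
  hf.clm (c • ContinuousLinearMap.id ℝ F)

theorem sub (hf : HasJet n f w) (hg : HasJet n g w') :
    HasJet n (fun h => f h - g h) (fun i => w i - w' i) := by
  refine (hf.add (hg.const_smul (-1))).congr (fun h => ?_) (fun i _ => ?_) <;>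
    module

theorem sum {ι : Type*} (s : Finset ι) {f : ι → ℝ → F} {w : ι → ℕ → F}
    (hf : ∀ i ∈ s, HasJet n (f i) (w i)) :
    HasJet n (fun h => ∑ i ∈ s, f i h) (fun k => ∑ i ∈ s, w i k) := by
  refine (IsBigO.fun_sum hf).congr_left fun h => ?_
  simp only [Finset.sum_sub_distrib, Finset.smul_sum]
  rw [Finset.sum_comm]

theorem mono (hf : HasJet n f w) {m : ℕ} (hmn : m ≤ n) : HasJet m f w := by
  obtain ⟨k, rfl⟩ := Nat.exists_eq_add_of_le hmn
  have h1 : (fun h : ℝ => f h - ∑ i ∈ Finset.range (m + k), h ^ i • w i)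
      =O[𝓝 0] fun h : ℝ => h ^ m := IsBigO.trans hf (isBigO_pow_of_le hmn)
  have h2 : (fun h : ℝ => ∑ i ∈ Finset.range k, h ^ (m + i) • w (m + i))
      =O[𝓝 0] fun h : ℝ => h ^ m := by
    refine IsBigO.fun_sum fun i _ => ?_
    have := (isBigO_pow_of_le (Nat.le_add_right m i)).smul
      (isBigO_refl (fun _ : ℝ => w (m + i)) (𝓝 0))
    refine this.trans ?_
    refine IsBigO.of_bound ‖w (m + i)‖ (Eventually.of_forall fun h => ?_)
    rw [norm_smul, mul_comm]
  refine (h1.add h2).congr_left fun h => ?_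
  rw [Finset.sum_range_add]; abel

theorem pow_smul (hf : HasJet n f w) (k : ℕ) :
    HasJet (k + n) (fun h => h ^ k • f h) (fun i => if i < k then 0 else w (i - k)) := by
  have := (isBigO_refl (fun h : ℝ => h ^ k) (𝓝 0)).smul hf
  refine (this.congr_left fun h => ?_).congr_right fun h => ?_
  · rw [Finset.sum_range_add, Finset.sum_eq_zero (s := Finset.range k), zero_add, smul_sub,
      Finset.smul_sum]
    · congr 1
      refine Finset.sum_congr rfl fun i _ => ?_
      simp [pow_add, mul_smul]
    · intro i hi
      simp [Finset.mem_range.1 hi]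
  · simp [pow_add]

theorem const (n : ℕ) (c : F) : HasJet n (fun _ => c) (fun i => if i = 0 then c else 0) := by
  rcases n with _ | n
  · simpa [HasJet] using isBigO_const_const c (one_ne_zero (α := ℝ)) (𝓝 (0 : ℝ))
  · have : (fun h : ℝ => c - ∑ i ∈ Finset.range (n + 1), h ^ i • (if i = 0 then c else 0))
        = fun _ => 0 := by
      funext h
      simp
    rw [HasJet, this]
    exact isBigO_zero _ _

theorem isBigO (hf : HasJet n f w) (hw : ∀ i < n, w i = 0) : f =O[𝓝 0] fun h : ℝ => h ^ n := by
  simpa [HasJet] using hf.congr_coeff (w' := fun _ => 0) hw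

theorem isBigO_sub (hf : HasJet n f w) (hg : HasJet n g w') (hw : ∀ i < n, w i = w' i) :
    (fun h => f h - g h) =O[𝓝 0] fun h : ℝ => h ^ n :=
  (hf.sub hg).isBigO fun i hi => sub_eq_zero.2 (hw i hi)

theorem of_isBigO_sub (hf : HasJet n f w) (hg : (fun h => g h - f h) =O[𝓝 0] fun h : ℝ => h ^ n) :
    HasJet n g w := by
  refine (IsBigO.add hf hg).congr_left fun h => ?_
  abel

theorem isBigO_sub_zero (hf : HasJet (n + 1) f w) :
    (fun h => f h - w 0) =O[𝓝 0] fun h : ℝ => h := by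
  simpa [HasJet] using hf.mono (m := 1) (by omega)

theorem tendsto (hf : HasJet (n + 1) f w) : Tendsto f (𝓝 0) (𝓝 (w 0)) := by
  have h1 : Tendsto (fun h => f h - w 0) (𝓝 0) (𝓝 0) :=
    hf.isBigO_sub_zero.trans_tendsto tendsto_id
  simpa using h1.add_const (w 0)

/-- The remainder of `f` has the remainder of `f'` as its derivative, so the mean value inequality
on the interval of radius `|h|` gains one order. -/
theorem integrate {f' : ℝ → F} (hf' : HasJet n f' w)
    (hf : ∀ᶠ h in 𝓝 0, HasDerivAt f (f' h) h) :
    HasJet (n + 1) f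
      (fun i => if i = 0 then f 0 else (1 / (i : ℝ)) • w (i - 1)) := by
  obtain ⟨C, hC⟩ := hf'.bound
  obtain ⟨ε, hε, hB⟩ := Metric.eventually_nhds_iff_ball.1 (hC.and hf)
  set p : ℝ → F := fun h => f h - ∑ i ∈ Finset.range (n + 1),
    h ^ i • (if i = 0 then f 0 else (1 / (i : ℝ)) • w (i - 1)) with hp
  have hp' : ∀ h ∈ Metric.ball (0 : ℝ) ε,
      HasDerivAt p (f' h - ∑ i ∈ Finset.range n, h ^ i • w i) h := by
    intro h hh
    refine (hB h hh).2.sub ?_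
    have h1 : ∀ i ∈ Finset.range n, HasDerivAt
        (fun t : ℝ => t ^ (i + 1) • ((1 / ((i + 1 : ℕ) : ℝ)) • w i)) (h ^ i • w i) h := by
      intro i _
      refine ((hasDerivAt_pow (i + 1) h).smul_const _).congr_deriv ?_
      rw [smul_smul]
      congr 1
      push_cast
      field_simp
    have h2 := (HasDerivAt.fun_sum h1).add_const (f 0)
    refine h2.congr_of_eventuallyEq (Eventually.of_forall fun t => ?_)
    simp [Finset.sum_range_succ']
  have hp0 : p 0 = 0 := by
    simp [hp, Finset.sum_range_succ']
  refine IsBigO.of_bound C ?_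
  filter_upwards [Metric.ball_mem_nhds (0 : ℝ) hε] with h hh
  have hsub : ∀ x ∈ Metric.closedBall (0 : ℝ) |h|, x ∈ Metric.ball (0 : ℝ) ε := by
    intro x hx
    simp only [Metric.mem_closedBall, Metric.mem_ball, dist_zero_right, Real.norm_eq_abs] at *
    exact hx.trans_lt hh
  have hC0 : ∀ x ∈ Metric.closedBall (0 : ℝ) |h|,
      ‖f' x - ∑ i ∈ Finset.range n, x ^ i • w i‖ ≤ |C| * |h| ^ n := by
    intro x hx
    refine ((hB x (hsub x hx)).1).trans ?_
    rw [norm_pow]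
    simp only [Metric.mem_closedBall, dist_zero_right] at hx
    gcongr
    exact le_abs_self C
  -- The mean value bound carries `|C|`. A negative `C` is compatible with the bound on `f'` only at
  -- `h = 0`, where the remainder vanishes.
  have hCn : 0 ≤ C ∨ h = 0 := by
    by_contra! hcon
    have := (hB h hh).1
    have h3 : 0 < ‖h ^ n‖ := norm_pos_iff.2 (pow_ne_zero n hcon.2)
    nlinarith [norm_nonneg (f' h - ∑ i ∈ Finset.range n, h ^ i • w i)]
  have key := (convex_closedBall (0 : ℝ) |h|).norm_image_sub_le_of_norm_hasDerivWithin_le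
    (x := 0) (y := h) (fun x hx => (hp' x (hsub x hx)).hasDerivWithinAt) hC0
    (by simp) (by simp)
  rw [hp0, sub_zero, sub_zero] at key
  change ‖p h‖ ≤ _
  rcases hCn with hC1 | rfl
  · rw [abs_of_nonneg hC1] at key
    simpa [pow_succ, mul_assoc] using key
  · simp [hp0]

end HasJet

/-- The coefficients of the jet of `f ∘ Q`, by recursion along `(f ∘ Q)' = (Df ∘ Q) Q'`, for a
curve `Q` whose jet has the coefficients `w`; they are meaningful up to degree `n`. -/
noncomputable def compCoeff : ℕ → ∀ {F : Type u} [NormedAddCommGroup F] [NormedSpace ℝ F],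
    (E → F) → (ℕ → E) → ℕ → F
  | 0, _, _, _, f, w, _ => f (w 0)
  | _ + 1, _, _, _, f, w, 0 => f (w 0)
  | n + 1, _, _, _, f, w, k + 1 => (1 / ((k + 1 : ℕ) : ℝ)) • ∑ j ∈ Finset.range (k + 1),
      compCoeff n (fderiv ℝ f) w (k - j) (((j + 1 : ℕ) : ℝ) • w (j + 1))

theorem compCoeff_zero (n : ℕ) {F : Type u} [NormedAddCommGroup F] [NormedSpace ℝ F]
    (f : E → F) (w : ℕ → E) : compCoeff n f w 0 = f (w 0) := by
  cases n <;> rfl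

/-- The polynomial with coefficients `w`, up to degree `m`. -/
def polyCurve (m : ℕ) (w : ℕ → E) (h : ℝ) : E := ∑ i ∈ Finset.range (m + 1), h ^ i • w i

theorem hasDerivAt_polyCurve (m : ℕ) (w : ℕ → E) (h : ℝ) :
    HasDerivAt (polyCurve m w)
      (∑ j ∈ Finset.range m, h ^ j • (((j + 1 : ℕ) : ℝ) • w (j + 1))) h := by
  have h1 : ∀ i ∈ Finset.range m, HasDerivAt
      (fun t : ℝ => t ^ (i + 1) • w (i + 1)) (h ^ i • (((i + 1 : ℕ) : ℝ) • w (i + 1))) h := by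
    intro i _
    refine ((hasDerivAt_pow (i + 1) h).smul_const _).congr_deriv ?_
    rw [smul_smul, mul_comm]
    simp
  refine ((HasDerivAt.fun_sum h1).add_const (w 0)).congr_of_eventuallyEq
    (Eventually.of_forall fun t => ?_)
  simp [polyCurve, Finset.sum_range_succ']

theorem polyCurve_zero (m : ℕ) (w : ℕ → E) : polyCurve m w 0 = w 0 := by
  simp [polyCurve, Finset.sum_range_succ']

/-- Induction on the order: the jet of `Df` along the curve gives that of `(f ∘ P)'`, which is
integrated. The target `F` stays universally quantified because the step passes from `f` to `Df`. -/
theorem hasJet_comp_polyCurve {U : Set E} (hU : IsOpen U) {w : ℕ → E} (hw : w 0 ∈ U) {m : ℕ}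
    (n : ℕ) (hnm : n ≤ m) : ∀ {F : Type u} [NormedAddCommGroup F] [NormedSpace ℝ F] {f : E → F},
    ContDiffOn ℝ ∞ f U → HasJet (n + 1) (fun h => f (polyCurve m w h)) (compCoeff n f w) := by
  have hP : ContinuousAt (polyCurve m w) 0 := (hasDerivAt_polyCurve m w 0).continuousAt
  have hPU : ∀ᶠ h in 𝓝 (0 : ℝ), polyCurve m w h ∈ U := by
    refine hP.eventually (hU.mem_nhds ?_)
    rwa [polyCurve_zero]
  induction n with
  | zero =>
    intro F _ _ f hf
    have hd : DifferentiableAt ℝ f (polyCurve m w 0) := by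
      rw [polyCurve_zero]
      exact (hf.contDiffAt (hU.mem_nhds hw)).differentiableAt (by simp)
    have := (hd.hasFDerivAt.comp_hasDerivAt 0 (hasDerivAt_polyCurve m w 0)).isBigO_sub
    simpa [HasJet, compCoeff, polyCurve_zero] using this
  | succ n ih =>
    intro F _ _ f hf
    have hf' : ContDiffOn ℝ ∞ (fderiv ℝ f) U := hf.fderiv_of_isOpen hU (by simp)
    have h1 := ih (by omega) hf'
    have hder : ∀ᶠ h in 𝓝 (0 : ℝ), HasDerivAt (fun h => f (polyCurve m w h))
        (∑ j ∈ Finset.range m, h ^ j • fderiv ℝ f (polyCurve m w h)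
          (((j + 1 : ℕ) : ℝ) • w (j + 1))) h := by
      filter_upwards [hPU] with h hh
      have hd : DifferentiableAt ℝ f (polyCurve m w h) :=
        (hf.contDiffAt (hU.mem_nhds hh)).differentiableAt (by simp)
      refine (hd.hasFDerivAt.comp_hasDerivAt h (hasDerivAt_polyCurve m w h)).congr_deriv ?_
      simp only [map_sum, map_smul]
    have h2 := HasJet.sum (n := n + 1) (Finset.range m)
      (f := fun j h => h ^ j • fderiv ℝ f (polyCurve m w h) (((j + 1 : ℕ) : ℝ) • w (j + 1)))
      fun j _ => ((h1.clm (ContinuousLinearMap.apply ℝ F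
        (((j + 1 : ℕ) : ℝ) • w (j + 1)))).pow_smul j).mono (by omega)
    refine (h2.integrate hder).congr_coeff fun i hi => ?_
    rcases i with _ | k
    · simp [compCoeff, polyCurve_zero]
    · simp only [Nat.add_eq_zero_iff, one_ne_zero, and_false, if_false, compCoeff,
        Nat.add_sub_cancel]
      congr 1
      -- The factor `h ^ j` shifts a jet by `j`, so only `j ≤ k` contributes in degree `k`.
      rw [← Finset.sum_range_add_sum_Ico _ (show k + 1 ≤ m by omega)]
      rw [Finset.sum_eq_zero (s := Finset.Ico _ _), add_zero]
      · refine Finset.sum_congr rfl fun j hj => ?_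
        rw [if_neg (by have := Finset.mem_range.1 hj; omega)]
        rfl
      · intro j hj
        rw [if_pos (by have := Finset.mem_Ico.1 hj; omega)]

/-- `Q` differs from its Taylor polynomial by `O(h ^ (n + 1))`. Strict differentiability makes `f`
Lipschitz near `w 0`, so the error keeps its order; for the polynomial curve the derivative is
explicit. -/
theorem HasJet.comp {U : Set E} (hU : IsOpen U) {F : Type u} [NormedAddCommGroup F]
    [NormedSpace ℝ F] {f : E → F} (hf : ContDiffOn ℝ ∞ f U) {n : ℕ} {Q : ℝ → E} {w : ℕ → E}
    (hQ : HasJet (n + 1) Q w) (hw : w 0 ∈ U) :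
    HasJet (n + 1) (fun h => f (Q h)) (compCoeff n f w) := by
  refine (hasJet_comp_polyCurve hU hw n le_rfl hf).of_isBigO_sub ?_
  have hs : HasStrictFDerivAt f (fderiv ℝ f (w 0)) (w 0) :=
    (hf.contDiffAt (hU.mem_nhds hw)).hasStrictFDerivAt (by simp)
  have hP : Tendsto (polyCurve n w) (𝓝 0) (𝓝 (w 0)) := by
    have := (hasDerivAt_polyCurve n w 0).continuousAt.tendsto
    rwa [polyCurve_zero] at this
  have ht : Tendsto (fun h => (Q h, polyCurve n w h)) (𝓝 0) (𝓝 (w 0, w 0)) :=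
    hQ.tendsto.prodMk_nhds hP
  exact (hs.isBigO_sub.comp_tendsto ht).trans hQ

end Jets

/-! ### Symmetry of higher derivatives -/

section Symmetry

variable {E : Type u} [NormedAddCommGroup E] [NormedSpace ℝ E]
variable {F : Type u} [NormedAddCommGroup F] [NormedSpace ℝ F]

theorem fderiv_fderiv_comm {U : Set E} (hU : IsOpen U) {f : E → F} (hf : ContDiffOn ℝ ∞ f U)
    {x : E} (hx : x ∈ U) (u v : E) :
    fderiv ℝ (fderiv ℝ f) x u v = fderiv ℝ (fderiv ℝ f) x v u :=
  (hf.contDiffAt (hU.mem_nhds hx)).isSymmSndFDerivAt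
    (by rw [minSmoothness_of_isRCLikeNormedField]; exact WithTop.coe_le_coe.2 le_top) u v

/-- A linear symmetry of the values of `f` on an open set passes to the derivative. -/
theorem fderiv_apply_eq_of_eqOn {U : Set E} (hU : IsOpen U) {f : E → F}
    (hf : ContDiffOn ℝ ∞ f U) {G : Type u} [NormedAddCommGroup G] [NormedSpace ℝ G]
    (L L' : F →L[ℝ] G) (hL : ∀ x ∈ U, L (f x) = L' (f x)) {x : E} (hx : x ∈ U) (u : E) :
    L (fderiv ℝ f x u) = L' (fderiv ℝ f x u) := by
  have hd : HasFDerivAt f (fderiv ℝ f x) x :=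
    ((hf.contDiffAt (hU.mem_nhds hx)).differentiableAt (by simp)).hasFDerivAt
  have h1 := L.hasFDerivAt.comp x hd
  have h2 := L'.hasFDerivAt.comp x hd
  have h3 : (L ∘ f) =ᶠ[𝓝 x] (L' ∘ f) := by
    filter_upwards [hU.mem_nhds hx] with y hy using hL y hy
  exact congrArg (fun T : E →L[ℝ] G => T u) (h1.unique (h2.congr_of_eventuallyEq h3))

theorem fderiv_apply₂_comm {U : Set E} (hU : IsOpen U) {f : E → E →L[ℝ] E →L[ℝ] F}
    (hf : ContDiffOn ℝ ∞ f U) (hs : ∀ x ∈ U, ∀ u v, f x u v = f x v u) {x : E} (hx : x ∈ U)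
    (t u v : E) : fderiv ℝ f x t u v = fderiv ℝ f x t v u := by
  let ap (u v : E) : (E →L[ℝ] E →L[ℝ] F) →L[ℝ] F :=
    (ContinuousLinearMap.apply ℝ F v).comp (ContinuousLinearMap.apply ℝ (E →L[ℝ] F) u)
  exact fderiv_apply_eq_of_eqOn hU hf (ap u v) (ap v u) (fun y hy => hs y hy u v) hx t

end Symmetry

/-! ### Exact formulas: Verlet iterates, the {1, 2, 4}-integrator and the tableaux -/

section Algebra

variable {E : Type*} [NormedAddCommGroup E] [NormedSpace ℝ E]
variable {F : Type*} [NormedAddCommGroup F] [NormedSpace ℝ F]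

/-- One step of size `h` of velocity Verlet. -/
noncomputable def verlet (a : E → E) (h : ℝ) (z : E × E) : E × E :=
  (z.1 + h • (z.2 + (h / 2) • a z.1),
    z.2 + (h / 2) • a z.1 + (h / 2) • a (z.1 + h • (z.2 + (h / 2) • a z.1)))

/-- Pull-backs compose in reverse: the leftmost factor moves the point first. -/
theorem T2_apply (a : E → E) (h : ℝ) (f : E × E → F) (z : E × E) :
    T2 a h f z = f (verlet a h z) := rfl

theorem T2_pow_apply (a : E → E) (h : ℝ) (i : ℕ) (f : E × E → F) (z : E × E) :
    (T2 a h ^ i) f z = f ((verlet a h)^[i] z) := by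
  induction i generalizing z with
  | zero => rfl
  | succ i ih => rw [pow_succ', Module.End.mul_apply, T2_apply, ih, Function.iterate_succ_apply]

theorem point_eq (a : E → E) (i k : ℕ) (h : ℝ) (z : E × E) :
    point a i k h z = ((verlet a (h / k))^[i] z).1 :=
  T2_pow_apply a (h / k) i Prod.fst z

theorem point_zero (a : E → E) (k : ℕ) (h : ℝ) (z : E × E) : point a 0 k h z = z.1 := rfl

/-- The velocity after `i` steps of `T₂(h/k)`. -/
theorem iterate_verlet_snd (a : E → E) (i k : ℕ) (h : ℝ) (z : E × E) :
    ((verlet a (h / k))^[i] z).2 =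
      z.2 + (h / k) • ∑ j ∈ Finset.range i,
        (1 / 2 : ℝ) • (force a j k h z + force a (j + 1) k h z) := by
  induction i with
  | zero => simp
  | succ i ih =>
    have h1 : (verlet a (h / k))^[i + 1] z = verlet a (h / k) ((verlet a (h / k))^[i] z) :=
      Function.iterate_succ_apply' _ _ _
    have h2 : ((verlet a (h / k))^[i + 1] z).2 = ((verlet a (h / k))^[i] z).2
        + (h / k / 2) • force a i k h z + (h / k / 2) • force a (i + 1) k h z := by
      rw [force, force, point_eq, point_eq, h1]; rfl
    rw [h2, ih, Finset.sum_range_succ]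
    module

theorem point_succ (a : E → E) (i k : ℕ) (h : ℝ) (z : E × E) :
    point a (i + 1) k h z = point a i k h z + (h / k) •
      (z.2 + (h / k) • ∑ j ∈ Finset.range i,
        (1 / 2 : ℝ) • (force a j k h z + force a (j + 1) k h z)
        + (h / k / 2) • force a i k h z) := by
  rw [← iterate_verlet_snd, point_eq, Function.iterate_succ_apply', force, point_eq]; rfl

variable (a : E → E) (h : ℝ) (z : E × E)

theorem force_zero (k : ℕ) : force a 0 k h z = a z.1 := rfl

theorem point_one_one : point a 1 1 h z = z.1 + h • z.2 + (h ^ 2 / 2) • a z.1 := by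
  simp only [point_succ, Finset.sum_range_zero, point_zero, force_zero]
  push_cast; module

theorem point_one_two : point a 1 2 h z = z.1 + (h / 2) • z.2 + (h ^ 2 / 8) • a z.1 := by
  simp only [point_succ, Finset.sum_range_zero, point_zero, force_zero]
  push_cast; module

theorem point_two_two :
    point a 2 2 h z = z.1 + h • z.2 + (h ^ 2 / 4) • (a z.1 + force a 1 2 h z) := by
  rw [point_succ, point_one_two]
  simp only [Finset.sum_range_succ, Finset.sum_range_zero, force_zero]
  push_cast; module

theorem point_one_four : point a 1 4 h z = z.1 + (h / 4) • z.2 + (h ^ 2 / 32) • a z.1 := by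
  simp only [point_succ, Finset.sum_range_zero, point_zero, force_zero]
  push_cast; module

theorem point_two_four :
    point a 2 4 h z = z.1 + (h / 2) • z.2 + (h ^ 2 / 16) • (a z.1 + force a 1 4 h z) := by
  rw [point_succ, point_one_four]
  simp only [Finset.sum_range_succ, Finset.sum_range_zero, force_zero]
  push_cast; module

theorem point_three_four :
    point a 3 4 h z = z.1 + (3 / 4 * h) • z.2 + (h ^ 2 / 32) •
      ((3 : ℝ) • a z.1 + (4 : ℝ) • force a 1 4 h z + (2 : ℝ) • force a 2 4 h z) := by
  rw [point_succ, point_two_four]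
  simp only [Finset.sum_range_succ, Finset.sum_range_zero, force_zero]
  push_cast; module

theorem point_four_four :
    point a 4 4 h z = z.1 + h • z.2 + (h ^ 2 / 16) •
      ((2 : ℝ) • a z.1 + (3 : ℝ) • force a 1 4 h z + (2 : ℝ) • force a 2 4 h z
        + force a 3 4 h z) := by
  rw [point_succ, point_three_four]
  simp only [Finset.sum_range_succ, Finset.sum_range_zero, force_zero]
  push_cast; module

theorem extrapolation_one_two_four :
    (extrapolation a {1, 2, 4} h : Module.End ℝ (E × E → F)) =
      (1 / 45 : ℝ) • T2 a h - (4 / 9 : ℝ) • T2 a (h / 2) ^ 2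
        + (64 / 45 : ℝ) • T2 a (h / 4) ^ 4 := by
  have e1 : ({1, 2, 4} : Finset ℕ).erase 1 = {2, 4} := by decide
  have e2 : ({1, 2, 4} : Finset ℕ).erase 2 = {1, 4} := by decide
  have e4 : ({1, 2, 4} : Finset ℕ).erase 4 = {1, 2} := by decide
  have c1 : extrapCoeff {1, 2, 4} 1 = 1 / 45 := by
    rw [extrapCoeff, e1, Finset.prod_pair (by decide)]; norm_num
  have c2 : extrapCoeff {1, 2, 4} 2 = -(4 / 9) := by
    rw [extrapCoeff, e2, Finset.prod_pair (by decide)]; norm_num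
  have c4 : extrapCoeff {1, 2, 4} 4 = 64 / 45 := by
    rw [extrapCoeff, e4, Finset.prod_pair (by decide)]; norm_num
  rw [extrapolation, Finset.sum_insert (by decide), Finset.sum_insert (by decide),
    Finset.sum_singleton, c1, c2, c4]
  simp only [Nat.cast_one, div_one, pow_one, Nat.cast_ofNat]
  module

/-- The step sizes are kept as `h` over a cast natural number so that `point_eq` and
`iterate_verlet_snd` match. -/
theorem extrapolation_apply (f : E × E → F) :
    extrapolation a {1, 2, 4} h f z =
      (1 / 45 : ℝ) • f ((verlet a (h / (1 : ℕ)))^[1] z)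
        - (4 / 9 : ℝ) • f ((verlet a (h / (2 : ℕ)))^[2] z)
        + (64 / 45 : ℝ) • f ((verlet a (h / (4 : ℕ)))^[4] z) := by
  rw [extrapolation_one_two_four]
  simp only [LinearMap.add_apply, LinearMap.sub_apply, LinearMap.smul_apply, Pi.add_apply,
    Pi.sub_apply, Pi.smul_apply, T2_pow_apply, T2_apply, Nat.cast_one, div_one, Nat.cast_ofNat,
    Function.iterate_one]

theorem integrator_fst :
    (integrator a {1, 2, 4} h z).1 = z.1 + h • z.2 + (h ^ 2 / 90) •
      ((7 : ℝ) • a z.1 + (24 : ℝ) • force a 1 4 h z + (16 : ℝ) • force a 2 4 h z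
        - (10 : ℝ) • force a 1 2 h z + (8 : ℝ) • force a 3 4 h z) := by
  change extrapolation a {1, 2, 4} h Prod.fst z = _
  rw [extrapolation_apply, ← point_eq, ← point_eq, ← point_eq, point_one_one,
    point_two_two, point_four_four]
  module

theorem integrator_snd :
    (integrator a {1, 2, 4} h z).2 = z.2 + (h / 90) •
      ((7 : ℝ) • a z.1 + (32 : ℝ) • force a 1 4 h z + (32 : ℝ) • force a 2 4 h z
        - (20 : ℝ) • force a 1 2 h z + (32 : ℝ) • force a 3 4 h z
        + (16 : ℝ) • force a 4 4 h z - (10 : ℝ) • force a 2 2 h z + force a 1 1 h z) := by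
  change extrapolation a {1, 2, 4} h Prod.snd z = _
  rw [extrapolation_apply, iterate_verlet_snd, iterate_verlet_snd, iterate_verlet_snd]
  simp only [Finset.sum_range_succ, Finset.sum_range_zero, force_zero]
  push_cast; module

theorem threeQuarterStar_eq :
    threeQuarterStar a h z =
      point a 3 4 h z + (h ^ 2 / 16) • (a (halfStar a h z) - force a 2 4 h z) := by
  rw [point_three_four, threeQuarterStar]; module

/-- Separates the two replacements: changing `a_{3/4}` will cost only `h² O(h^5)`, while changing
the half-step forces gives the leading term. -/
theorem oneStar_eq :
    oneStar a h z = oneDagger a h z - (h ^ 2 / 14) •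
        (a (halfStar a h z) + (4 : ℝ) • force a 2 4 h z - (5 : ℝ) • force a 1 2 h z)
      + (h ^ 2 / 7) • (a (threeQuarterStar a h z) - force a 3 4 h z) := by
  rw [oneStar, oneDagger]; module

/-- The tableau is strictly lower triangular, so the stage equations, solved in order, force each `Q
i`; conversely these points satisfy them. -/
theorem tableau124_isStep_iff (w : E × E) :
    tableau124.IsStep a h z w ↔ w = integrator a {1, 2, 4} h z := by
  constructor
  · rintro ⟨Q, hQ, h1, h2⟩
    have hQ0 := hQ 0
    have hQ1 := hQ 1
    have hQ2 := hQ 2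
    have hQ3 := hQ 3
    have hQ4 := hQ 4
    have hQ5 := hQ 5
    have hQ6 := hQ 6
    have hQ7 := hQ 7
    simp [tableau124, Fin.sum_univ_eight] at hQ0 hQ1 hQ2 hQ3 hQ4 hQ5 hQ6 hQ7 h1 h2
    have e0 : Q 0 = z.1 := hQ0
    have e1 : Q 1 = point a 1 4 h z := by rw [hQ1, e0, point_one_four]; module
    have e2 : Q 2 = point a 1 2 h z := by rw [hQ2, e0, point_one_two]; module
    have e3 : Q 3 = point a 2 4 h z := by
      rw [hQ3, e0, e1, point_two_four, force]; module
    have e4 : Q 4 = point a 3 4 h z := by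
      rw [hQ4, e0, e1, e3, point_three_four, force, force]; module
    have e5 : Q 5 = point a 1 1 h z := by rw [hQ5, e0, point_one_one]; module
    have e6 : Q 6 = point a 2 2 h z := by
      rw [hQ6, e0, e2, point_two_two, force]; module
    have e7 : Q 7 = point a 4 4 h z := by
      rw [hQ7, e0, e1, e3, e4, point_four_four, force, force, force]; module
    rw [e0, e1, e2, e3, e4] at h1
    rw [e0, e1, e2, e3, e4, e5, e6, e7] at h2
    refine Prod.ext ?_ ?_
    · rw [h1, integrator_fst]; simp only [force]; module
    · rw [h2, integrator_snd]; simp only [force]; module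
  · rintro rfl
    refine ⟨![z.1, point a 1 4 h z, point a 1 2 h z, point a 2 4 h z, point a 3 4 h z,
      point a 1 1 h z, point a 2 2 h z, point a 4 4 h z], fun i => ?_, ?_, ?_⟩
    · fin_cases i <;> simp [tableau124, Fin.sum_univ_eight]
      · rw [point_one_four]; module
      · rw [point_one_two]; module
      · rw [point_two_four, force]; module
      · rw [point_three_four, force, force]; module
      · rw [point_one_one]; module
      · rw [point_two_two, force]; module
      · rw [point_four_four, force, force, force]; module
    · rw [integrator_fst]
      simp [tableau124, Fin.sum_univ_eight, force]
      module
    · rw [integrator_snd]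
      simp [tableau124, Fin.sum_univ_eight, force]
      module

theorem tableauAlbrecht_isStep_iff (w : E × E) :
    tableauAlbrecht.IsStep a h z w ↔ w = albrecht a h z := by
  constructor
  · rintro ⟨Q, hQ, h1, h2⟩
    have hQ0 := hQ 0
    have hQ1 := hQ 1
    have hQ2 := hQ 2
    have hQ3 := hQ 3
    have hQ4 := hQ 4
    simp [tableauAlbrecht, Fin.sum_univ_five] at hQ0 hQ1 hQ2 hQ3 hQ4 h1 h2
    have e0 : Q 0 = z.1 := hQ0
    have e1 : Q 1 = point a 1 4 h z := by rw [hQ1, e0, point_one_four]; module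
    have e2 : Q 2 = halfStar a h z := by rw [hQ2, e0, e1, halfStar, force]; module
    have e3 : Q 3 = threeQuarterStar a h z := by
      rw [hQ3, e0, e1, e2, threeQuarterStar, force]; module
    have e4 : Q 4 = oneStar a h z := by
      rw [hQ4, e1, e2, e3, oneStar, force]; module
    rw [e0, e1, e2, e3] at h1
    rw [e0, e1, e2, e3, e4] at h2
    refine Prod.ext ?_ ?_
    · rw [h1, albrecht, force]; module
    · rw [h2, albrecht, force]; module
  · rintro rfl
    refine ⟨![z.1, point a 1 4 h z, halfStar a h z, threeQuarterStar a h z, oneStar a h z],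
      fun i => ?_, ?_, ?_⟩
    · fin_cases i <;> simp [tableauAlbrecht, Fin.sum_univ_five]
      · rw [point_one_four]; module
      · rw [halfStar, force]; module
      · rw [threeQuarterStar, force]; module
      · rw [oneStar, force]; module
    · simp [tableauAlbrecht, Fin.sum_univ_five, albrecht, force]
      module
    · simp [tableauAlbrecht, Fin.sum_univ_five, albrecht, force]
      module

end Algebra

/-! ### Elementary differentials and the jet of the force along a curve -/

section Nystrom

set_option maxSynthPendingDepth 3

variable {E : Type u} [NormedAddCommGroup E] [NormedSpace ℝ E]

/-- The coefficients of a curve in the elementary differentials of `q'' = a(q)`, up to degree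
`5`: of `v`, `a`, `Da v`, `Da a`, `D²a(v, v)`, `Da² v`, `D²a(v, a)` and `D³a(v, v, v)`. -/
structure NystromCoeff where
  v : ℝ
  a : ℝ
  av : ℝ
  aa : ℝ
  avv : ℝ
  aav : ℝ
  ava : ℝ
  avvv : ℝ

/-- The jet of a curve with the coefficients `c`. -/
noncomputable def posJet (a : E → E) (q v : E) (c : NystromCoeff) : ℕ → E
  | 0 => q
  | 1 => c.v • v
  | 2 => c.a • a q
  | 3 => c.av • fderiv ℝ a q v
  | 4 => c.aa • fderiv ℝ a q (a q) + c.avv • fderiv ℝ (fderiv ℝ a) q v v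
  | 5 => c.aav • fderiv ℝ a q (fderiv ℝ a q v) + c.ava • fderiv ℝ (fderiv ℝ a) q v (a q)
      + c.avvv • fderiv ℝ (fderiv ℝ (fderiv ℝ a)) q v v v
  -- A default value: only degrees below 6 are ever used.
  | _ => 0

/-- The jet of the force along a curve with the coefficients `c`. -/
noncomputable def forceJet (a : E → E) (q v : E) (c : NystromCoeff) : ℕ → E
  | 0 => a q
  | 1 => c.v • fderiv ℝ a q v
  | 2 => c.a • fderiv ℝ a q (a q) + (c.v ^ 2 / 2) • fderiv ℝ (fderiv ℝ a) q v v
  | 3 => c.av • fderiv ℝ a q (fderiv ℝ a q v)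
      + (c.v * c.a) • fderiv ℝ (fderiv ℝ a) q v (a q)
      + (c.v ^ 3 / 6) • fderiv ℝ (fderiv ℝ (fderiv ℝ a)) q v v v
  | 4 => c.aa • fderiv ℝ a q (fderiv ℝ a q (a q))
      + c.avv • fderiv ℝ a q (fderiv ℝ (fderiv ℝ a) q v v)
      + (c.v * c.av) • fderiv ℝ (fderiv ℝ a) q v (fderiv ℝ a q v)
      + (c.a ^ 2 / 2) • fderiv ℝ (fderiv ℝ a) q (a q) (a q)
      + (c.v ^ 2 * c.a / 2) • fderiv ℝ (fderiv ℝ (fderiv ℝ a)) q v v (a q)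
      + (c.v ^ 4 / 24) • fderiv ℝ (fderiv ℝ (fderiv ℝ (fderiv ℝ a))) q v v v v
  | 5 => c.aav • fderiv ℝ a q (fderiv ℝ a q (fderiv ℝ a q v))
      + c.ava • fderiv ℝ a q (fderiv ℝ (fderiv ℝ a) q v (a q))
      + c.avvv • fderiv ℝ a q (fderiv ℝ (fderiv ℝ (fderiv ℝ a)) q v v v)
      + (c.v * c.aa) • fderiv ℝ (fderiv ℝ a) q v (fderiv ℝ a q (a q))
      + (c.v * c.avv) • fderiv ℝ (fderiv ℝ a) q v (fderiv ℝ (fderiv ℝ a) q v v)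
      + (c.a * c.av) • fderiv ℝ (fderiv ℝ a) q (a q) (fderiv ℝ a q v)
      + (c.v ^ 2 * c.av / 2) • fderiv ℝ (fderiv ℝ (fderiv ℝ a)) q v v (fderiv ℝ a q v)
      + (c.v * c.a ^ 2 / 2) • fderiv ℝ (fderiv ℝ (fderiv ℝ a)) q v (a q) (a q)
      + (c.v ^ 3 * c.a / 6) • fderiv ℝ (fderiv ℝ (fderiv ℝ (fderiv ℝ a))) q v v v (a q)
      + (c.v ^ 5 / 120) • fderiv ℝ (fderiv ℝ (fderiv ℝ (fderiv ℝ (fderiv ℝ a)))) q v v v v v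
  | _ => 0

variable {U : Set E}

section Coefficients

variable {F : Type u} [NormedAddCommGroup F] [NormedSpace ℝ F] {f : E → F} {w : ℕ → E}

theorem compCoeff_one (n : ℕ) :
    compCoeff (n + 1) f w 1 = fderiv ℝ f (w 0) (w 1) := by
  simp [compCoeff, compCoeff_zero]

theorem compCoeff_two (n : ℕ) :
    compCoeff (n + 2) f w 2 = fderiv ℝ f (w 0) (w 2)
      + (1 / 2 : ℝ) • fderiv ℝ (fderiv ℝ f) (w 0) (w 1) (w 1) := by
  simp only [compCoeff, Finset.sum_range_succ, Finset.sum_range_zero, compCoeff_zero,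
    compCoeff_one, map_smul, Nat.sub_zero, Nat.sub_self, zero_add]
  push_cast
  module

/-- From degree 3 on, the recursion yields the same multilinear term with its arguments in different
orders; symmetry of the derivatives merges them into the usual Taylor coefficients. -/
theorem compCoeff_three (hU : IsOpen U) (hw : w 0 ∈ U) (hf : ContDiffOn ℝ ∞ f U) (n : ℕ) :
    compCoeff (n + 3) f w 3 = fderiv ℝ f (w 0) (w 3)
      + fderiv ℝ (fderiv ℝ f) (w 0) (w 1) (w 2)
      + (1 / 6 : ℝ) • fderiv ℝ (fderiv ℝ (fderiv ℝ f)) (w 0) (w 1) (w 1) (w 1) := by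
  have h0 := fderiv_fderiv_comm hU hf hw (w 2) (w 1)
  simp only [compCoeff, Finset.sum_range_succ, Finset.sum_range_zero, compCoeff_zero,
    compCoeff_one, compCoeff_two, map_smul, Nat.sub_zero, Nat.sub_self, zero_add,
    Nat.add_one_sub_one, add_apply, smul_apply, h0]
  push_cast
  module

theorem compCoeff_four (hU : IsOpen U) (hw : w 0 ∈ U) (hf : ContDiffOn ℝ ∞ f U) (n : ℕ) :
    compCoeff (n + 4) f w 4 = fderiv ℝ f (w 0) (w 4)
      + fderiv ℝ (fderiv ℝ f) (w 0) (w 1) (w 3)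
      + (1 / 2 : ℝ) • fderiv ℝ (fderiv ℝ f) (w 0) (w 2) (w 2)
      + (1 / 2 : ℝ) • fderiv ℝ (fderiv ℝ (fderiv ℝ f)) (w 0) (w 1) (w 1) (w 2)
      + (1 / 24 : ℝ) •
        fderiv ℝ (fderiv ℝ (fderiv ℝ (fderiv ℝ f))) (w 0) (w 1) (w 1) (w 1) (w 1) := by
  have hf1 : ContDiffOn ℝ ∞ (fderiv ℝ f) U := hf.fderiv_of_isOpen hU (by simp)
  have hf2 : ContDiffOn ℝ ∞ (fderiv ℝ (fderiv ℝ f)) U := hf1.fderiv_of_isOpen hU (by simp)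
  have h0 := fderiv_fderiv_comm hU hf hw (w 3) (w 1)
  have h1 := fderiv_apply₂_comm hU hf2 (fun x hx => fderiv_fderiv_comm hU hf hx) hw
    (w 1) (w 2) (w 1)
  rw [compCoeff]
  simp only [Finset.sum_range_succ, Finset.sum_range_zero, compCoeff_zero,
    compCoeff_one, compCoeff_two, compCoeff_three hU hw hf1, map_smul, Nat.sub_zero,
    Nat.sub_self, zero_add, Nat.reduceAdd, Nat.reduceSub,
    add_apply, smul_apply, h0, h1]
  push_cast
  module

theorem compCoeff_five (hU : IsOpen U) (hw : w 0 ∈ U) (hf : ContDiffOn ℝ ∞ f U) (n : ℕ) :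
    compCoeff (n + 5) f w 5 = fderiv ℝ f (w 0) (w 5)
      + fderiv ℝ (fderiv ℝ f) (w 0) (w 1) (w 4)
      + fderiv ℝ (fderiv ℝ f) (w 0) (w 2) (w 3)
      + (1 / 2 : ℝ) • fderiv ℝ (fderiv ℝ (fderiv ℝ f)) (w 0) (w 1) (w 1) (w 3)
      + (1 / 2 : ℝ) • fderiv ℝ (fderiv ℝ (fderiv ℝ f)) (w 0) (w 1) (w 2) (w 2)
      + (1 / 6 : ℝ) •
        fderiv ℝ (fderiv ℝ (fderiv ℝ (fderiv ℝ f))) (w 0) (w 1) (w 1) (w 1) (w 2)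
      + (1 / 120 : ℝ) • fderiv ℝ (fderiv ℝ (fderiv ℝ (fderiv ℝ (fderiv ℝ f)))) (w 0)
          (w 1) (w 1) (w 1) (w 1) (w 1) := by
  have hf1 : ContDiffOn ℝ ∞ (fderiv ℝ f) U := hf.fderiv_of_isOpen hU (by simp)
  have hf2 : ContDiffOn ℝ ∞ (fderiv ℝ (fderiv ℝ f)) U := hf1.fderiv_of_isOpen hU (by simp)
  have hf3 : ContDiffOn ℝ ∞ (fderiv ℝ (fderiv ℝ (fderiv ℝ f))) U :=
    hf2.fderiv_of_isOpen hU (by simp)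
  have h0 := fderiv_fderiv_comm hU hf hw
  have h1 := fun x (hx : x ∈ U) =>
    fderiv_apply₂_comm hU hf2 (fun x hx => fderiv_fderiv_comm hU hf hx) hx
  -- Two adjacent transpositions: the last pair of slots, then the first.
  have h2 : fderiv ℝ (fderiv ℝ (fderiv ℝ f)) (w 0) (w 2) (w 2) (w 1)
      = fderiv ℝ (fderiv ℝ (fderiv ℝ f)) (w 0) (w 1) (w 2) (w 2) := by
    rw [h1 _ hw, fderiv_fderiv_comm hU hf1 hw]
  -- Symmetry of the third derivative in its last two slots, differentiated once more.
  have h3 : fderiv ℝ (fderiv ℝ (fderiv ℝ (fderiv ℝ f))) (w 0) (w 1) (w 1) (w 2) (w 1)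
      = fderiv ℝ (fderiv ℝ (fderiv ℝ (fderiv ℝ f))) (w 0) (w 1) (w 1) (w 1) (w 2) := by
    let ap (x y : E) : (E →L[ℝ] E →L[ℝ] E →L[ℝ] F) →L[ℝ] F :=
      ((ContinuousLinearMap.apply ℝ F y).comp (ContinuousLinearMap.apply ℝ (E →L[ℝ] F) x)).comp
        (ContinuousLinearMap.apply ℝ (E →L[ℝ] E →L[ℝ] F) (w 1))
    exact fderiv_apply_eq_of_eqOn hU hf3 (ap (w 2) (w 1)) (ap (w 1) (w 2))
      (fun y hy => h1 y hy _ _ _) hw (w 1)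
  rw [compCoeff]
  simp only [Finset.sum_range_succ, Finset.sum_range_zero, compCoeff_zero,
    compCoeff_one, compCoeff_two, compCoeff_three hU hw hf1, compCoeff_four hU hw hf1, map_smul,
    Nat.sub_zero, Nat.sub_self, zero_add, Nat.reduceAdd, Nat.reduceSub,
    add_apply, smul_apply, h0 (w 4) (w 1),
    h0 (w 3) (w 2), h1 _ hw (w 1) (w 3) (w 1), h2, h3]
  push_cast
  module

end Coefficients

variable {a : E → E}

theorem compCoeff_posJet (hU : IsOpen U) (ha : ContDiffOn ℝ ∞ a U) {q : E} (hq : q ∈ U) (v : E)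
    (c : NystromCoeff) (n i : ℕ) (hi : i ≤ n) (h5 : i ≤ 5) :
    compCoeff n a (posJet a q v c) i = forceJet a q v c i := by
  obtain ⟨m, rfl⟩ := Nat.exists_eq_add_of_le' hi
  interval_cases i
  · exact compCoeff_zero _ _ _
  · rw [compCoeff_one]
    simp only [posJet, forceJet, map_smul]
  · rw [compCoeff_two]
    simp only [posJet, forceJet, map_smul, smul_apply]
    module
  · rw [compCoeff_three hU hq ha]
    simp only [posJet, forceJet, map_smul, smul_apply]
    module
  · rw [compCoeff_four hU hq ha]
    simp only [posJet, forceJet, map_smul, map_add, smul_apply]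
    module
  · rw [compCoeff_five hU hq ha]
    simp only [posJet, forceJet, map_smul, map_add, smul_apply]
    module

/-- The jet of the force along a curve. -/
theorem HasJet.force (hU : IsOpen U) (ha : ContDiffOn ℝ ∞ a U) {q : E} (hq : q ∈ U) {v : E}
    {c : NystromCoeff} {n : ℕ} (hn : n < 6) {Q : ℝ → E}
    (hQ : HasJet (n + 1) Q (posJet a q v c)) :
    HasJet (n + 1) (fun h => a (Q h)) (forceJet a q v c) :=
  (HasJet.comp hU ha hQ hq).congr_coeff fun i hi =>
    compCoeff_posJet hU ha hq v c n i (by omega) (by omega)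

end Nystrom

/-! ### Jets of all evaluation points -/

section Stages

variable {E : Type u} [NormedAddCommGroup E] [NormedSpace ℝ E] {a : E → E} {U : Set E}

/-- The factor `h²` means that forces modulo `h^4` determine positions modulo `h^6`; hence the shift
of the coefficients by two. -/
theorem HasJet.position {a : E → E} {q v : E} {c : NystromCoeff} {Q R : ℝ → E} {ρ : ℕ → E}
    (hR : HasJet 4 R ρ) (hQ : ∀ h : ℝ, Q h = q + (c.v * h) • v + h ^ 2 • R h)
    (hρ : ∀ i < 4, ρ i = posJet a q v c (i + 2)) : HasJet 6 Q (posJet a q v c) := by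
  refine (((HasJet.const 6 q).add (((HasJet.const 5 v).const_smul c.v).pow_smul 1)).add
    (hR.pow_smul 2)).congr (fun h => ?_) fun i hi => ?_
  · rw [hQ]; module
  · rcases i with _ | _ | i
    · simp [posJet]
    · simp [posJet]
    · rw [← hρ i (by omega)]
      simp

/-- The coefficients of `q_{1/4}`. -/
noncomputable def coeffOneFour : NystromCoeff :=
  ⟨1 / 4, 1 / 32, 0, 0, 0, 0, 0, 0⟩

/-- The coefficients of `q_{1/2}`. -/
noncomputable def coeffOneTwo : NystromCoeff :=
  ⟨1 / 2, 1 / 8, 0, 0, 0, 0, 0, 0⟩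

/-- The coefficients of `q_{1/1}`. -/
noncomputable def coeffOneOne : NystromCoeff :=
  ⟨1, 1 / 2, 0, 0, 0, 0, 0, 0⟩

/-- The coefficients of `q_{2/4}`. -/
noncomputable def coeffTwoFour : NystromCoeff :=
  ⟨1 / 2, 1 / 8, 1 / 64, 1 / 512, 1 / 512, 0, 1 / 2048, 1 / 6144⟩

/-- The coefficients of `q_{3/4}`. -/
noncomputable def coeffThreeFour : NystromCoeff :=
  ⟨3 / 4, 9 / 32, 1 / 16, 3 / 256, 3 / 256, 1 / 1024, 5 / 1024, 5 / 3072⟩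

/-- The coefficients of `q_{4/4}`. -/
noncomputable def coeffFourFour : NystromCoeff :=
  ⟨1, 1 / 2, 5 / 32, 5 / 128, 5 / 128, 3 / 512, 23 / 1024, 23 / 3072⟩

/-- The coefficients of `q_{2/2}`. -/
noncomputable def coeffTwoTwo : NystromCoeff :=
  ⟨1, 1 / 2, 1 / 8, 1 / 32, 1 / 32, 0, 1 / 64, 1 / 192⟩

/-- The coefficients of `q*_{1/2}`. -/
noncomputable def coeffHalfStar : NystromCoeff :=
  ⟨1 / 2, 1 / 8, 1 / 24, 1 / 192, 1 / 192, 0, 1 / 768, 1 / 2304⟩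

/-- The coefficients of `q†_1`. -/
noncomputable def coeffOneDagger : NystromCoeff :=
  ⟨1, 1 / 2, 5 / 28, 5 / 112, 5 / 112, 3 / 224, 13 / 448, 13 / 1344⟩

/-- The coefficients of `q*_{3/4}`. -/
noncomputable def coeffThreeQuarterStar : NystromCoeff :=
  ⟨3 / 4, 9 / 32, 1 / 16, 3 / 256, 3 / 256, 1 / 384, 5 / 1024, 5 / 3072⟩

/-- The coefficients of `q*_1`. -/
noncomputable def coeffOneStar : NystromCoeff :=
  ⟨1, 1 / 2, 5 / 28, 5 / 112, 5 / 112, 1 / 168, 13 / 448, 13 / 1344⟩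

theorem hasJet_one_four (a : E → E) (q v : E) :
    HasJet 6 (fun h => point a 1 4 h (q, v)) (posJet a q v coeffOneFour) := by
  refine HasJet.position ((HasJet.const 4 (a q)).const_smul (1 / 32)) (fun h => ?_) fun i hi => ?_
  · simp only [point_one_four, coeffOneFour]; module
  · interval_cases i <;> simp [coeffOneFour, posJet]

theorem hasJet_force_one_four (hU : IsOpen U) (ha : ContDiffOn ℝ ∞ a U) {q : E} (hq : q ∈ U)
    (v : E) : HasJet 6 (fun h => force a 1 4 h (q, v)) (forceJet a q v coeffOneFour) :=
  (hasJet_one_four a q v).force hU ha hq (by omega)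

theorem hasJet_one_two (a : E → E) (q v : E) :
    HasJet 6 (fun h => point a 1 2 h (q, v)) (posJet a q v coeffOneTwo) := by
  refine HasJet.position ((HasJet.const 4 (a q)).const_smul (1 / 8)) (fun h => ?_) fun i hi => ?_
  · simp only [point_one_two, coeffOneTwo]; module
  · interval_cases i <;> simp [coeffOneTwo, posJet]

theorem hasJet_force_one_two (hU : IsOpen U) (ha : ContDiffOn ℝ ∞ a U) {q : E} (hq : q ∈ U)
    (v : E) : HasJet 6 (fun h => force a 1 2 h (q, v)) (forceJet a q v coeffOneTwo) :=
  (hasJet_one_two a q v).force hU ha hq (by omega)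

theorem hasJet_one_one (a : E → E) (q v : E) :
    HasJet 6 (fun h => point a 1 1 h (q, v)) (posJet a q v coeffOneOne) := by
  refine HasJet.position ((HasJet.const 4 (a q)).const_smul (1 / 2)) (fun h => ?_) fun i hi => ?_
  · simp only [point_one_one, coeffOneOne]; module
  · interval_cases i <;> simp [coeffOneOne, posJet]

theorem hasJet_force_one_one (hU : IsOpen U) (ha : ContDiffOn ℝ ∞ a U) {q : E} (hq : q ∈ U)
    (v : E) : HasJet 6 (fun h => force a 1 1 h (q, v)) (forceJet a q v coeffOneOne) :=
  (hasJet_one_one a q v).force hU ha hq (by omega)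

theorem hasJet_two_four (hU : IsOpen U) (ha : ContDiffOn ℝ ∞ a U) {q : E} (hq : q ∈ U) (v : E) :
    HasJet 6 (fun h => point a 2 4 h (q, v)) (posJet a q v coeffTwoFour) := by
  refine HasJet.position
    (((HasJet.const 4 (a q)).const_smul (1 / 16)).add
      (((hasJet_force_one_four hU ha hq v).mono (show 4 ≤ 6 by omega)).const_smul (1 / 16)))
    (fun h => ?_) fun i hi => ?_
  · simp only [point_two_four, coeffTwoFour]; module
  · interval_cases i <;> simp [coeffTwoFour, coeffOneFour, posJet, forceJet] <;> module

theorem hasJet_force_two_four (hU : IsOpen U) (ha : ContDiffOn ℝ ∞ a U) {q : E} (hq : q ∈ U)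
    (v : E) : HasJet 6 (fun h => force a 2 4 h (q, v)) (forceJet a q v coeffTwoFour) :=
  (hasJet_two_four hU ha hq v).force hU ha hq (by omega)

theorem hasJet_three_four (hU : IsOpen U) (ha : ContDiffOn ℝ ∞ a U) {q : E} (hq : q ∈ U) (v : E) :
    HasJet 6 (fun h => point a 3 4 h (q, v)) (posJet a q v coeffThreeFour) := by
  refine HasJet.position
    ((((HasJet.const 4 (a q)).const_smul (3 / 32)).add
      (((hasJet_force_one_four hU ha hq v).mono (show 4 ≤ 6 by omega)).const_smul (4 / 32))).add
      (((hasJet_force_two_four hU ha hq v).mono (show 4 ≤ 6 by omega)).const_smul (2 / 32)))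
    (fun h => ?_) fun i hi => ?_
  · simp only [point_three_four, coeffThreeFour]; module
  · interval_cases i <;> simp [coeffThreeFour, coeffOneFour, coeffTwoFour, posJet, forceJet] <;>
      module

theorem hasJet_force_three_four (hU : IsOpen U) (ha : ContDiffOn ℝ ∞ a U) {q : E} (hq : q ∈ U)
    (v : E) : HasJet 6 (fun h => force a 3 4 h (q, v)) (forceJet a q v coeffThreeFour) :=
  (hasJet_three_four hU ha hq v).force hU ha hq (by omega)

theorem hasJet_four_four (hU : IsOpen U) (ha : ContDiffOn ℝ ∞ a U) {q : E} (hq : q ∈ U) (v : E) :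
    HasJet 6 (fun h => point a 4 4 h (q, v)) (posJet a q v coeffFourFour) := by
  refine HasJet.position
    (((((HasJet.const 4 (a q)).const_smul (2 / 16)).add
      (((hasJet_force_one_four hU ha hq v).mono (show 4 ≤ 6 by omega)).const_smul (3 / 16))).add
      (((hasJet_force_two_four hU ha hq v).mono (show 4 ≤ 6 by omega)).const_smul (2 / 16))).add
      (((hasJet_force_three_four hU ha hq v).mono (show 4 ≤ 6 by omega)).const_smul (1 / 16)))
    (fun h => ?_) fun i hi => ?_
  · simp only [point_four_four, coeffFourFour]; module
  · interval_cases i <;> simp [coeffFourFour, coeffOneFour, coeffTwoFour, coeffThreeFour, posJet,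
      forceJet] <;> module

theorem hasJet_force_four_four (hU : IsOpen U) (ha : ContDiffOn ℝ ∞ a U) {q : E} (hq : q ∈ U)
    (v : E) : HasJet 6 (fun h => force a 4 4 h (q, v)) (forceJet a q v coeffFourFour) :=
  (hasJet_four_four hU ha hq v).force hU ha hq (by omega)

theorem hasJet_two_two (hU : IsOpen U) (ha : ContDiffOn ℝ ∞ a U) {q : E} (hq : q ∈ U) (v : E) :
    HasJet 6 (fun h => point a 2 2 h (q, v)) (posJet a q v coeffTwoTwo) := by
  refine HasJet.position
    (((HasJet.const 4 (a q)).const_smul (1 / 4)).add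
      (((hasJet_force_one_two hU ha hq v).mono (show 4 ≤ 6 by omega)).const_smul (1 / 4)))
    (fun h => ?_) fun i hi => ?_
  · simp only [point_two_two, coeffTwoTwo]; module
  · interval_cases i <;> simp [coeffTwoTwo, coeffOneTwo, posJet, forceJet] <;> module

theorem hasJet_force_two_two (hU : IsOpen U) (ha : ContDiffOn ℝ ∞ a U) {q : E} (hq : q ∈ U)
    (v : E) : HasJet 6 (fun h => force a 2 2 h (q, v)) (forceJet a q v coeffTwoTwo) :=
  (hasJet_two_two hU ha hq v).force hU ha hq (by omega)

theorem hasJet_halfStar (hU : IsOpen U) (ha : ContDiffOn ℝ ∞ a U) {q : E} (hq : q ∈ U) (v : E) :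
    HasJet 6 (fun h => halfStar a h (q, v)) (posJet a q v coeffHalfStar) := by
  refine HasJet.position
    (((HasJet.const 4 (a q)).const_smul (-1 / 24)).add
      (((hasJet_force_one_four hU ha hq v).mono (show 4 ≤ 6 by omega)).const_smul (4 / 24)))
    (fun h => ?_) fun i hi => ?_
  · simp only [halfStar, coeffHalfStar]; module
  · interval_cases i <;> simp [coeffHalfStar, coeffOneFour, posJet, forceJet] <;> module

theorem hasJet_force_halfStar (hU : IsOpen U) (ha : ContDiffOn ℝ ∞ a U) {q : E} (hq : q ∈ U)
    (v : E) : HasJet 6 (fun h => a (halfStar a h (q, v))) (forceJet a q v coeffHalfStar) :=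
  (hasJet_halfStar hU ha hq v).force hU ha hq (by omega)

theorem hasJet_oneDagger (hU : IsOpen U) (ha : ContDiffOn ℝ ∞ a U) {q : E} (hq : q ∈ U) (v : E) :
    HasJet 6 (fun h => oneDagger a h (q, v)) (posJet a q v coeffOneDagger) := by
  refine HasJet.position
    ((((((hasJet_force_one_four hU ha hq v).mono (show 4 ≤ 6 by omega)).const_smul (6 / 14)).add
      (((hasJet_force_two_four hU ha hq v).mono (show 4 ≤ 6 by omega)).const_smul (4 / 14))).add
      (((hasJet_force_one_two hU ha hq v).mono (show 4 ≤ 6 by omega)).const_smul (-5 / 14))).add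
      (((hasJet_force_three_four hU ha hq v).mono (show 4 ≤ 6 by omega)).const_smul (2 / 14)))
    (fun h => ?_) fun i hi => ?_
  · simp only [oneDagger, coeffOneDagger]; module
  · interval_cases i <;> simp [coeffOneDagger, coeffOneFour, coeffTwoFour, coeffOneTwo,
      coeffThreeFour, posJet, forceJet] <;> module

theorem hasJet_force_oneDagger (hU : IsOpen U) (ha : ContDiffOn ℝ ∞ a U) {q : E} (hq : q ∈ U)
    (v : E) : HasJet 6 (fun h => a (oneDagger a h (q, v))) (forceJet a q v coeffOneDagger) :=
  (hasJet_oneDagger hU ha hq v).force hU ha hq (by omega)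

/-- Only `aav` differs from `coeffThreeFour`: `a*_{1/2}` and `a_{2/4}` first differ in degree 3, by
`(1/24 - 1/64) Da² v`, and the weight `2/32` makes this `5/3072`. -/
theorem hasJet_threeQuarterStar (hU : IsOpen U) (ha : ContDiffOn ℝ ∞ a U) {q : E} (hq : q ∈ U) (v :
    E) :
    HasJet 6 (fun h => threeQuarterStar a h (q, v)) (posJet a q v coeffThreeQuarterStar) := by
  refine HasJet.position
    ((((HasJet.const 4 (a q)).const_smul (3 / 32)).add
      (((hasJet_force_one_four hU ha hq v).mono (show 4 ≤ 6 by omega)).const_smul (4 / 32))).add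
      (((hasJet_force_halfStar hU ha hq v).mono (show 4 ≤ 6 by omega)).const_smul (2 / 32)))
    (fun h => ?_) fun i hi => ?_
  · simp only [threeQuarterStar, coeffThreeQuarterStar]; module
  · interval_cases i <;> simp [coeffThreeQuarterStar, coeffOneFour, coeffHalfStar, posJet, forceJet]
      <;> module

theorem hasJet_force_threeQuarterStar (hU : IsOpen U) (ha : ContDiffOn ℝ ∞ a U) {q : E} (hq : q ∈ U)
    (v : E) : HasJet 6 (fun h => a (threeQuarterStar a h (q, v))) (forceJet a q v
        coeffThreeQuarterStar) :=
  (hasJet_threeQuarterStar hU ha hq v).force hU ha hq (by omega)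

/-- Only `aav` differs from `coeffOneDagger`, by `-(1/14)(1/24 + 4/64) = -5/672`; the weights `1 + 4
- 5 = 0` cancel the lower degrees. -/
theorem hasJet_oneStar (hU : IsOpen U) (ha : ContDiffOn ℝ ∞ a U) {q : E} (hq : q ∈ U) (v : E) :
    HasJet 6 (fun h => oneStar a h (q, v)) (posJet a q v coeffOneStar) := by
  refine HasJet.position
    (((((hasJet_force_one_four hU ha hq v).mono (show 4 ≤ 6 by omega)).const_smul (6 / 14)).add
      (((hasJet_force_halfStar hU ha hq v).mono (show 4 ≤ 6 by omega)).const_smul (-1 / 14))).add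
      (((hasJet_force_threeQuarterStar hU ha hq v).mono (show 4 ≤ 6 by omega)).const_smul (2 / 14)))
    (fun h => ?_) fun i hi => ?_
  · simp only [oneStar, coeffOneStar]; module
  · interval_cases i <;> simp [coeffOneStar, coeffOneFour, coeffHalfStar, coeffThreeQuarterStar,
      posJet, forceJet] <;> module

theorem hasJet_force_oneStar (hU : IsOpen U) (ha : ContDiffOn ℝ ∞ a U) {q : E} (hq : q ∈ U)
    (v : E) : HasJet 6 (fun h => a (oneStar a h (q, v))) (forceJet a q v coeffOneStar) :=
  (hasJet_oneStar hU ha hq v).force hU ha hq (by omega)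

end Stages

/-! ### Consolidation of forces and comparison of the two methods -/

section Order

variable {E : Type u} [NormedAddCommGroup E] [NormedSpace ℝ E] {a : E → E} {U : Set E}

theorem isBigO_pow_smul {F : Type*} [NormedAddCommGroup F] [NormedSpace ℝ F] {f : ℝ → F} {n : ℕ}
    (hf : f =O[𝓝 0] fun h : ℝ => h ^ n) (k : ℕ) :
    (fun h => h ^ k • f h) =O[𝓝 0] fun h : ℝ => h ^ (k + n) := by
  simpa [pow_add] using (isBigO_refl (fun h : ℝ => h ^ k) (𝓝 0)).smul hf

/-- The three points share the coefficients `v` and `a`. With these fixed, the force jet up to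
degree 5 is affine in the other coefficients, and those of `q*_{1/2}` are the weighted mean of the
others. The same reason gives `fullForce_isBigO`. -/
theorem halfForce_isBigO (hU : IsOpen U) (ha : ContDiffOn ℝ ∞ a U) {q : E} (hq : q ∈ U) (v : E) :
    (fun h : ℝ => (16 : ℝ) • force a 2 4 h (q, v) - (10 : ℝ) • force a 1 2 h (q, v)
      - (6 : ℝ) • a (halfStar a h (q, v))) =O[𝓝 0] fun h : ℝ => h ^ 6 := by
  refine ((((hasJet_force_two_four hU ha hq v).const_smul 16).sub
    ((hasJet_force_one_two hU ha hq v).const_smul 10)).sub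
    ((hasJet_force_halfStar hU ha hq v).const_smul 6)).isBigO fun i hi => ?_
  interval_cases i <;>
    simp only [coeffTwoFour, coeffOneTwo, coeffHalfStar, forceJet] <;> module

theorem fullForce_isBigO (hU : IsOpen U) (ha : ContDiffOn ℝ ∞ a U) {q : E} (hq : q ∈ U) (v : E) :
    (fun h : ℝ => (16 : ℝ) • force a 4 4 h (q, v) - (10 : ℝ) • force a 2 2 h (q, v)
      + force a 1 1 h (q, v) - (7 : ℝ) • a (oneDagger a h (q, v)))
      =O[𝓝 0] fun h : ℝ => h ^ 6 := by
  refine (((((hasJet_force_four_four hU ha hq v).const_smul 16).sub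
    ((hasJet_force_two_two hU ha hq v).const_smul 10)).add
    (hasJet_force_one_one hU ha hq v)).sub
    ((hasJet_force_oneDagger hU ha hq v).const_smul 7)).isBigO fun i hi => ?_
  interval_cases i <;>
    simp only [coeffFourFour, coeffTwoTwo, coeffOneOne, coeffOneDagger, forceJet] <;> module

theorem threeQuarterStar_sub_isBigO (hU : IsOpen U) (ha : ContDiffOn ℝ ∞ a U) {q : E}
    (hq : q ∈ U) (v : E) :
    (fun h : ℝ => threeQuarterStar a h (q, v) - point a 3 4 h (q, v))
      =O[𝓝 0] fun h : ℝ => h ^ 5 := by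
  refine ((hasJet_threeQuarterStar hU ha hq v).mono (show 5 ≤ 6 by omega)).isBigO_sub
    ((hasJet_three_four hU ha hq v).mono (by omega)) fun i hi => ?_
  interval_cases i <;> simp [coeffThreeQuarterStar, coeffThreeFour, posJet]

theorem oneStar_sub_oneDagger_isBigO (hU : IsOpen U) (ha : ContDiffOn ℝ ∞ a U) {q : E}
    (hq : q ∈ U) (v : E) :
    (fun h : ℝ => oneStar a h (q, v) - oneDagger a h (q, v)) =O[𝓝 0] fun h : ℝ => h ^ 5 := by
  refine ((hasJet_oneStar hU ha hq v).mono (show 5 ≤ 6 by omega)).isBigO_sub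
    ((hasJet_oneDagger hU ha hq v).mono (by omega)) fun i hi => ?_
  interval_cases i <;> simp [coeffOneStar, coeffOneDagger, posJet]

theorem force_threeQuarterStar_sub_isBigO (hU : IsOpen U) (ha : ContDiffOn ℝ ∞ a U) {q : E}
    (hq : q ∈ U) (v : E) :
    (fun h : ℝ => a (threeQuarterStar a h (q, v)) - force a 3 4 h (q, v))
      =O[𝓝 0] fun h : ℝ => h ^ 5 := by
  refine ((hasJet_force_threeQuarterStar hU ha hq v).mono (show 5 ≤ 6 by omega)).isBigO_sub
    ((hasJet_force_three_four hU ha hq v).mono (by omega)) fun i hi => ?_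
  interval_cases i <;> simp [coeffThreeQuarterStar, coeffThreeFour, forceJet]

theorem oneStar_expansion_isBigO (hU : IsOpen U) (ha : ContDiffOn ℝ ∞ a U) {q : E}
    (hq : q ∈ U) (v : E) :
    (fun h : ℝ => oneStar a h (q, v) - (oneDagger a h (q, v) - (h ^ 2 / 14) •
        (a (halfStar a h (q, v)) + (4 : ℝ) • force a 2 4 h (q, v)
          - (5 : ℝ) • force a 1 2 h (q, v)))) =O[𝓝 0] fun h : ℝ => h ^ 7 := by
  refine (isBigO_pow_smul ((force_threeQuarterStar_sub_isBigO hU ha hq v).const_smul_left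
    (1 / 7 : ℝ)) 2).congr_left fun h => ?_
  rw [oneStar_eq]
  simp only [Pi.smul_apply]
  module

/-- The constant is `(32/90)(1/384 - 1/1024) = 1/1728`, from the `aav` coefficients; its counterpart
in `velocity_error_one` is `(7/90)(1/168 - 3/224) = -1/1728`. -/
theorem velocity_error_threeQuarter (hU : IsOpen U) (ha : ContDiffOn ℝ ∞ a U) {q : E}
    (hq : q ∈ U) (v : E) :
    (fun h : ℝ => (h / 90) • (32 : ℝ) •
        (a (threeQuarterStar a h (q, v)) - force a 3 4 h (q, v))
      - (h ^ 6 / 1728) • (fderiv ℝ a q ^ 3) v) =O[𝓝 0] fun h : ℝ => h ^ 7 := by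
  have h1 := ((((hasJet_force_threeQuarterStar hU ha hq v).sub
    (hasJet_force_three_four hU ha hq v)).const_smul (32 / 90)).sub
    -- A jet modulo `h^6` whose only coefficient sits in degree 5; the outer factor `h` is restored
    -- afterwards.
    ((HasJet.const 1 ((1 / 1728 : ℝ) • (fderiv ℝ a q ^ 3) v)).pow_smul 5)).isBigO fun i hi => by
      interval_cases i <;>
        simp [coeffThreeQuarterStar, coeffThreeFour, forceJet, pow_succ]
      module
  refine (isBigO_pow_smul h1 1).congr_left fun h => ?_
  module

theorem velocity_error_one (hU : IsOpen U) (ha : ContDiffOn ℝ ∞ a U) {q : E}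
    (hq : q ∈ U) (v : E) :
    (fun h : ℝ => (h / 90) • (7 : ℝ) •
        (a (oneStar a h (q, v)) - a (oneDagger a h (q, v)))
      + (h ^ 6 / 1728) • (fderiv ℝ a q ^ 3) v) =O[𝓝 0] fun h : ℝ => h ^ 7 := by
  have h1 := ((((hasJet_force_oneStar hU ha hq v).sub
    (hasJet_force_oneDagger hU ha hq v)).const_smul (7 / 90)).add
    ((HasJet.const 1 ((1 / 1728 : ℝ) • (fderiv ℝ a q ^ 3) v)).pow_smul 5)).isBigO fun i hi => by
      interval_cases i <;>
        simp [coeffOneStar, coeffOneDagger, forceJet, pow_succ]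
      module
  refine (isBigO_pow_smul h1 1).congr_left fun h => ?_
  module

theorem velocity_error_sum (hU : IsOpen U) (ha : ContDiffOn ℝ ∞ a U) {q : E}
    (hq : q ∈ U) (v : E) :
    (fun h : ℝ => (h / 90) •
        ((32 : ℝ) • (a (threeQuarterStar a h (q, v)) - force a 3 4 h (q, v))
          + (7 : ℝ) • (a (oneStar a h (q, v)) - a (oneDagger a h (q, v)))))
      =O[𝓝 0] fun h : ℝ => h ^ 7 := by
  refine ((velocity_error_threeQuarter hU ha hq v).add
    (velocity_error_one hU ha hq v)).congr_left fun h => ?_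
  module

theorem integrator_sub_albrecht_fst (hU : IsOpen U) (ha : ContDiffOn ℝ ∞ a U) {q : E}
    (hq : q ∈ U) (v : E) :
    (fun h : ℝ => (integrator a {1, 2, 4} h (q, v)).1 - (albrecht a h (q, v)).1)
      =O[𝓝 0] fun h : ℝ => h ^ 7 := by
  have h1 := ((halfForce_isBigO hU ha hq v).trans (isBigO_pow_of_le (m := 5) (by omega))).sub
    ((force_threeQuarterStar_sub_isBigO hU ha hq v).const_smul_left (8 : ℝ))
  refine (isBigO_pow_smul (h1.const_smul_left (1 / 90 : ℝ)) 2).congr_left fun h => ?_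
  rw [integrator_fst, albrecht]
  simp only [Pi.smul_apply]
  module

theorem integrator_sub_albrecht_snd (hU : IsOpen U) (ha : ContDiffOn ℝ ∞ a U) {q : E}
    (hq : q ∈ U) (v : E) :
    (fun h : ℝ => (integrator a {1, 2, 4} h (q, v)).2 - (albrecht a h (q, v)).2)
      =O[𝓝 0] fun h : ℝ => h ^ 7 := by
  have h1 := ((halfForce_isBigO hU ha hq v).const_smul_left (2 : ℝ)).add
    (fullForce_isBigO hU ha hq v)
  refine ((isBigO_pow_smul (h1.const_smul_left (1 / 90 : ℝ)) 1).sub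
    (velocity_error_sum hU ha hq v)).congr_left fun h => ?_
  rw [integrator_snd, albrecht]
  simp only [Pi.smul_apply]
  module

/-! ### Jet of the exact solution and sixth order -/

/-- The coefficients of the exact solution. -/
noncomputable def coeffExact : NystromCoeff :=
  ⟨1, 1 / 2, 1 / 6, 1 / 24, 1 / 24, 1 / 120, 1 / 40, 1 / 120⟩

/-- The coefficients of the antiderivative, with constant term `c`, of a curve with the
coefficients `w`. -/
noncomputable def antiderivJet (c : E) (w : ℕ → E) (i : ℕ) : E :=
  if i = 0 then c else (1 / (i : ℝ)) • w (i - 1)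

/-- The fixed-point property of the double integration, which determines `coeffExact`. -/
theorem antiderivJet_forceJet (a : E → E) (q v : E) (i : ℕ) (hi : i < 6) :
    antiderivJet q (antiderivJet v (forceJet a q v coeffExact)) i
      = posJet a q v coeffExact i := by
  interval_cases i <;> simp [antiderivJet, posJet, forceJet, coeffExact] <;> module

variable {q v : ℝ → E} {q₀ v₀ : E}

theorem IsSolution.hasJet_snd (hs : IsSolution a (q₀, v₀) q v) (hU : IsOpen U)
    (ha : ContDiffOn ℝ ∞ a U) (hq : q₀ ∈ U) {n : ℕ} (hn : n < 6)
    (h : HasJet (n + 1) q (posJet a q₀ v₀ coeffExact)) :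
    HasJet (n + 2) v (antiderivJet v₀ (forceJet a q₀ v₀ coeffExact)) := by
  have := (h.force hU ha hq hn).integrate hs.deriv_v
  rwa [hs.v_zero] at this

theorem IsSolution.hasJet_fst (hs : IsSolution a (q₀, v₀) q v) (hU : IsOpen U)
    (ha : ContDiffOn ℝ ∞ a U) (hq : q₀ ∈ U) {n : ℕ} (hn : n < 6)
    (h : HasJet (n + 1) q (posJet a q₀ v₀ coeffExact)) :
    HasJet (n + 3) q (antiderivJet q₀ (antiderivJet v₀ (forceJet a q₀ v₀ coeffExact))) := by
  have := (hs.hasJet_snd hU ha hq hn h).integrate hs.deriv_q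
  rwa [hs.q_zero] at this

/-- Picard iteration on jets: from `q = q₀ + O(h)`, the known order grows as 1, 3, 5, 7. No
smoothness of the solution is presupposed. -/
theorem IsSolution.hasJet (hs : IsSolution a (q₀, v₀) q v) (hU : IsOpen U)
    (ha : ContDiffOn ℝ ∞ a U) (hq : q₀ ∈ U) :
    HasJet 6 q (posJet a q₀ v₀ coeffExact) := by
  have h1 : HasJet (0 + 1) q (posJet a q₀ v₀ coeffExact) := by
    have := hs.deriv_q.self_of_nhds.isBigO_sub
    simpa [HasJet, posJet, hs.q_zero] using this
  have h3 : HasJet (2 + 1) q (posJet a q₀ v₀ coeffExact) :=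
    (hs.hasJet_fst hU ha hq (by omega) h1).congr_coeff
      fun i hi => antiderivJet_forceJet a q₀ v₀ i (by omega)
  have h5 : HasJet (4 + 1) q (posJet a q₀ v₀ coeffExact) :=
    (hs.hasJet_fst hU ha hq (by omega) h3).congr_coeff
      fun i hi => antiderivJet_forceJet a q₀ v₀ i (by omega)
  exact ((hs.hasJet_fst hU ha hq (by omega) h5).mono (by omega)).congr_coeff
      fun i hi => antiderivJet_forceJet a q₀ v₀ i (by omega)

/-- The order conditions. Degree 6 lies beyond `posJet`, so the doubly integrated force jet is
compared directly with the weighted stage forces, needed here only modulo `h^5`; for the velocity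
they are needed modulo `h^6`. -/
theorem IsSolution.sub_integrator_fst (hs : IsSolution a (q₀, v₀) q v) (hU : IsOpen U)
    (ha : ContDiffOn ℝ ∞ a U) (hq : q₀ ∈ U) :
    (fun h : ℝ => q h - (integrator a {1, 2, 4} h (q₀, v₀)).1) =O[𝓝 0] fun h : ℝ => h ^ 7 := by
  have hR := ((((((HasJet.const 5 (a q₀)).const_smul 7).add
    (((hasJet_force_one_four hU ha hq v₀).mono (by omega)).const_smul 24)).add
    (((hasJet_force_two_four hU ha hq v₀).mono (by omega)).const_smul 16)).sub
    (((hasJet_force_one_two hU ha hq v₀).mono (by omega)).const_smul 10)).add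
    (((hasJet_force_three_four hU ha hq v₀).mono (by omega)).const_smul 8)).const_smul (1 / 90)
  have hI := ((HasJet.const 7 q₀).add ((HasJet.const 6 v₀).pow_smul 1)).add (hR.pow_smul 2)
  have hq8 : HasJet 7 q _ := (hs.hasJet_fst hU ha hq (by omega) (hs.hasJet hU ha hq)).mono (by
      omega)
  refine (hq8.isBigO_sub hI fun i hi => ?_).congr_left fun h => ?_
  · interval_cases i <;>
      simp [antiderivJet, forceJet, coeffExact, coeffOneFour, coeffTwoFour, coeffOneTwo,
        coeffThreeFour] <;> module
  · rw [integrator_fst]; module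

theorem IsSolution.sub_integrator_snd (hs : IsSolution a (q₀, v₀) q v) (hU : IsOpen U)
    (ha : ContDiffOn ℝ ∞ a U) (hq : q₀ ∈ U) :
    (fun h : ℝ => v h - (integrator a {1, 2, 4} h (q₀, v₀)).2) =O[𝓝 0] fun h : ℝ => h ^ 7 := by
  have hR := (((((((((HasJet.const 6 (a q₀)).const_smul 7).add
    ((hasJet_force_one_four hU ha hq v₀).const_smul 32)).add
    ((hasJet_force_two_four hU ha hq v₀).const_smul 32)).sub
    ((hasJet_force_one_two hU ha hq v₀).const_smul 20)).add
    ((hasJet_force_three_four hU ha hq v₀).const_smul 32)).add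
    ((hasJet_force_four_four hU ha hq v₀).const_smul 16)).sub
    ((hasJet_force_two_two hU ha hq v₀).const_smul 10)).add
    (hasJet_force_one_one hU ha hq v₀)).const_smul (1 / 90)
  have hI := (HasJet.const 7 v₀).add (hR.pow_smul 1)
  have hv : HasJet 7 v _ := hs.hasJet_snd hU ha hq (by omega) (hs.hasJet hU ha hq)
  refine (hv.isBigO_sub hI fun i hi => ?_).congr_left fun h => ?_
  · interval_cases i <;>
      simp [antiderivJet, forceJet, coeffExact, coeffOneFour, coeffTwoFour, coeffOneTwo,
        coeffThreeFour, coeffFourFour, coeffTwoTwo, coeffOneOne] <;> module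
  · rw [integrator_snd]; module

end Order

end MultiProduct

/-! ### The assembled theorem -/

theorem mainTheorem6 {E : Type*} [NormedAddCommGroup E] [NormedSpace ℝ E]
    [FiniteDimensional ℝ E] (a : E → E) :
    -- the expansion of the set {1, 2, 4}
    (∀ h : ℝ, (extrapolation a {1, 2, 4} h : Module.End ℝ (E × E → E)) =
      (1 / 45 : ℝ) • T2 a h - (4 / 9 : ℝ) • T2 a (h / 2) ^ 2
        + (64 / 45 : ℝ) • T2 a (h / 4) ^ 4) ∧
    -- exact form of the integrator, with its evaluation points
    (∀ (h : ℝ) (q₀ v₀ : E),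
      point a 1 1 h (q₀, v₀) = q₀ + h • v₀ + (h ^ 2 / 2) • a q₀ ∧
      point a 1 2 h (q₀, v₀) = q₀ + (h / 2) • v₀ + (h ^ 2 / 8) • a q₀ ∧
      point a 2 2 h (q₀, v₀) = q₀ + h • v₀ + (h ^ 2 / 4) • (a q₀ + force a 1 2 h (q₀, v₀)) ∧
      point a 1 4 h (q₀, v₀) = q₀ + (h / 4) • v₀ + (h ^ 2 / 32) • a q₀ ∧
      point a 2 4 h (q₀, v₀) =
        q₀ + (h / 2) • v₀ + (h ^ 2 / 16) • (a q₀ + force a 1 4 h (q₀, v₀)) ∧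
      point a 3 4 h (q₀, v₀) = q₀ + (3 / 4 * h) • v₀ + (h ^ 2 / 32) •
        ((3 : ℝ) • a q₀ + (4 : ℝ) • force a 1 4 h (q₀, v₀)
          + (2 : ℝ) • force a 2 4 h (q₀, v₀)) ∧
      point a 4 4 h (q₀, v₀) = q₀ + h • v₀ + (h ^ 2 / 16) •
        ((2 : ℝ) • a q₀ + (3 : ℝ) • force a 1 4 h (q₀, v₀)
          + (2 : ℝ) • force a 2 4 h (q₀, v₀) + force a 3 4 h (q₀, v₀)) ∧
      (integrator a {1, 2, 4} h (q₀, v₀)).1 = q₀ + h • v₀ + (h ^ 2 / 90) •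
        ((7 : ℝ) • a q₀ + (24 : ℝ) • force a 1 4 h (q₀, v₀)
          + (16 : ℝ) • force a 2 4 h (q₀, v₀) - (10 : ℝ) • force a 1 2 h (q₀, v₀)
          + (8 : ℝ) • force a 3 4 h (q₀, v₀)) ∧
      (integrator a {1, 2, 4} h (q₀, v₀)).2 = v₀ + (h / 90) •
        ((7 : ℝ) • a q₀ + (32 : ℝ) • force a 1 4 h (q₀, v₀)
          + (32 : ℝ) • force a 2 4 h (q₀, v₀) - (20 : ℝ) • force a 1 2 h (q₀, v₀)
          + (32 : ℝ) • force a 3 4 h (q₀, v₀) + (16 : ℝ) • force a 4 4 h (q₀, v₀)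
          - (10 : ℝ) • force a 2 2 h (q₀, v₀) + force a 1 1 h (q₀, v₀))) ∧
    -- eight force evaluations for the {1, 2, 4}-integrator, five for Albrecht's
    (∀ (h : ℝ) (z w : E × E),
      (tableau124.IsStep a h z w ↔ w = integrator a {1, 2, 4} h z) ∧
      (tableauAlbrecht.IsStep a h z w ↔ w = albrecht a h z)) ∧
    -- replacing the half-step force in `q_{3/4}`
    (∀ (h : ℝ) (z : E × E),
      threeQuarterStar a h z =
        point a 3 4 h z + (h ^ 2 / 16) • (a (halfStar a h z) - force a 2 4 h z)) ∧
    -- the asymptotic part, for a smooth force near the initial position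
    ∀ (U : Set E), IsOpen U → ContDiffOn ℝ ∞ a U → ∀ q₀ ∈ U, ∀ v₀ : E,
      -- the force consolidations at `h / 2` and at `h`
      ((fun h : ℝ => (16 : ℝ) • force a 2 4 h (q₀, v₀) - (10 : ℝ) • force a 1 2 h (q₀, v₀)
          - (6 : ℝ) • a (halfStar a h (q₀, v₀))) =O[𝓝 0] fun h : ℝ => h ^ 6) ∧
      ((fun h : ℝ => (16 : ℝ) • force a 4 4 h (q₀, v₀) - (10 : ℝ) • force a 2 2 h (q₀, v₀)
          + force a 1 1 h (q₀, v₀) - (7 : ℝ) • a (oneDagger a h (q₀, v₀)))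
        =O[𝓝 0] fun h : ℝ => h ^ 6) ∧
      -- the effect of the replacement on the evaluation points
      ((fun h : ℝ => threeQuarterStar a h (q₀, v₀) - point a 3 4 h (q₀, v₀))
        =O[𝓝 0] fun h : ℝ => h ^ 5) ∧
      ((fun h : ℝ => oneStar a h (q₀, v₀) - (oneDagger a h (q₀, v₀) - (h ^ 2 / 14) •
          (a (halfStar a h (q₀, v₀)) + (4 : ℝ) • force a 2 4 h (q₀, v₀)
            - (5 : ℝ) • force a 1 2 h (q₀, v₀)))) =O[𝓝 0] fun h : ℝ => h ^ 7) ∧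
      ((fun h : ℝ => oneStar a h (q₀, v₀) - oneDagger a h (q₀, v₀))
        =O[𝓝 0] fun h : ℝ => h ^ 5) ∧
      -- the two resulting errors of order `h ^ 6` in the velocity, and their cancellation
      ((fun h : ℝ => (h / 90) • (32 : ℝ) •
            (a (threeQuarterStar a h (q₀, v₀)) - force a 3 4 h (q₀, v₀))
          - (h ^ 6 / 1728) • (fderiv ℝ a q₀ ^ 3) v₀) =O[𝓝 0] fun h : ℝ => h ^ 7) ∧
      ((fun h : ℝ => (h / 90) • (7 : ℝ) •
            (a (oneStar a h (q₀, v₀)) - a (oneDagger a h (q₀, v₀)))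
          + (h ^ 6 / 1728) • (fderiv ℝ a q₀ ^ 3) v₀) =O[𝓝 0] fun h : ℝ => h ^ 7) ∧
      ((fun h : ℝ => (h / 90) •
          ((32 : ℝ) • (a (threeQuarterStar a h (q₀, v₀)) - force a 3 4 h (q₀, v₀))
            + (7 : ℝ) • (a (oneStar a h (q₀, v₀)) - a (oneDagger a h (q₀, v₀)))))
        =O[𝓝 0] fun h : ℝ => h ^ 7) ∧
      -- Albrecht's integrator agrees with the {1, 2, 4}-integrator up to `O(h ^ 7)`
      ((fun h : ℝ => (integrator a {1, 2, 4} h (q₀, v₀)).1 - (albrecht a h (q₀, v₀)).1)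
        =O[𝓝 0] fun h : ℝ => h ^ 7) ∧
      ((fun h : ℝ => (integrator a {1, 2, 4} h (q₀, v₀)).2 - (albrecht a h (q₀, v₀)).2)
        =O[𝓝 0] fun h : ℝ => h ^ 7) ∧
      -- both integrators are of sixth order
      ∀ q v : ℝ → E, IsSolution a (q₀, v₀) q v →
        ((fun h : ℝ => q h - (integrator a {1, 2, 4} h (q₀, v₀)).1)
          =O[𝓝 0] fun h : ℝ => h ^ 7) ∧
        ((fun h : ℝ => v h - (integrator a {1, 2, 4} h (q₀, v₀)).2)
          =O[𝓝 0] fun h : ℝ => h ^ 7) ∧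
        ((fun h : ℝ => q h - (albrecht a h (q₀, v₀)).1) =O[𝓝 0] fun h : ℝ => h ^ 7) ∧
        ((fun h : ℝ => v h - (albrecht a h (q₀, v₀)).2) =O[𝓝 0] fun h : ℝ => h ^ 7) := by
  refine ⟨extrapolation_one_two_four a, fun h q₀ v₀ => ⟨point_one_one a h _, point_one_two a h _,
    point_two_two a h _, point_one_four a h _, point_two_four a h _, point_three_four a h _,
    point_four_four a h _, integrator_fst a h _, integrator_snd a h _⟩,
    fun h z w => ⟨tableau124_isStep_iff a h z w, tableauAlbrecht_isStep_iff a h z w⟩,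
    threeQuarterStar_eq a, fun U hU ha q₀ hq v₀ => ?_⟩
  have h1 := integrator_sub_albrecht_fst hU ha hq v₀
  have h2 := integrator_sub_albrecht_snd hU ha hq v₀
  refine ⟨halfForce_isBigO hU ha hq v₀, fullForce_isBigO hU ha hq v₀,
    threeQuarterStar_sub_isBigO hU ha hq v₀, oneStar_expansion_isBigO hU ha hq v₀,
    oneStar_sub_oneDagger_isBigO hU ha hq v₀, velocity_error_threeQuarter hU ha hq v₀,
    velocity_error_one hU ha hq v₀, velocity_error_sum hU ha hq v₀, h1, h2, fun q v hs => ?_⟩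
  have h3 := hs.sub_integrator_fst hU ha hq
  have h4 := hs.sub_integrator_snd hU ha hq
  exact ⟨h3, h4, (h3.add h1).congr_left fun h => sub_add_sub_cancel _ _ _,
    (h4.add h2).congr_left fun h => sub_add_sub_cancel _ _ _⟩
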